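/- Let $C^\infty(S^{1|2})$ be the algebra of superfunctions $f=f_0(x)+\theta_1f_1(x)+\theta_2f_2(x)+\theta_1\theta_2f_{12}(x)$, where $\theta_1,\theta_2$ are odd Grassmann coordinates and $f_0,f_1,f_2,f_{12}$ are smooth complex-valued functions of the affine coordinate $x\in\mathbb R$ of $S^1=\mathbb{RP}^1$ (as usual for this problem, everything is written in the affine chart, so that $x$ and $x^2$ are admissible functions and no condition at infinity is imposed). Put $\overline D_i=\partial_{\theta_i}-\theta_i\partial_x$, write $f'=\partial_xf$, and let $\tilde{\cdot}$ denote parity. For homogeneous $f$ let $$X_f=f\partial_x-(-1)^{\tilde f}\tfrac12\big(\overline D_1(f)\overline D_1+\overline D_2(f)\overline D_2\big),\qquad L^\lambda_{X_f}=X_f+\lambda f'\quad(\lambda\in\mathbb C),$$ both extended linearly in $f$. Let $\mathfrak{spo}(2|2)$ be the span of the $X_f$ with $f\in\{1,x,\theta_1,\theta_2,\theta_1\theta_2,x^2,x\theta_1,x\theta_2\}$. Let $\lambda,\mu\in\mathbb C$ and $\delta=\mu-\lambda$. For $k\in\frac{\mathbb N}{2}=\{0,\frac12,1,\dots\}$ let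 $\mathcal D^k_{\lambda\mu}$ be the space of operators on $C^\infty(S^{1|2})$ of the form $\sum_{l+\frac m2+\frac n2\le k}a_{l,m,n}\,\partial_x^l\overline D_1^m\overline D_2^n$ with $a_{l,m,n}\in C^\infty(S^{1|2})$, let $\mathcal D^{-1/2}_{\lambda\mu}=0$, and let $\mathcal D_{\lambda\mu}=\bigcup_k\mathcal D^k_{\lambda\mu}$. The Lie derivative $\mathcal L_{X_f}D=L^\mu_{X_f}\circ D-(-1)^{\tilde f\tilde D}D\circ L^\lambda_{X_f}$ (for homogeneous $f,D$, extended bilinearly) preserves each $\mathcal D^k_{\lambda\mu}$. Hence it induces an action $L_{X_f}[D]=[\mathcal L_{X_f}D]$ on the space of symbols $\mathcal S_\delta=\bigoplus_{k\in\frac{\mathbb N}{2}}\mathcal S^k_\delta$, where $\mathcal S^k_\delta=\mathcal D^k_{\lambda\mu}/\mathcal D^{k-\frac12}_{\lambda\mu}$. Put $\alpha_k=(\delta-k)^2$ if $k\in\mathbb N$ and $\alpha_k=(\delta-k)^2-\frac14$ if $k\in\frac12+\mathbb N$. The value $\delta$ is called critical if $\alpha_k=\alpha_l$ for some $k,l\in\frac{\mathbb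 N}{2}$ with $l<k$. **Theorem.** If $\delta=\mu-\lambda$ is not critical, there exists a unique $\mathfrak{spo}(2|2)$-equivariant quantization, that is, a unique $\mathbb C$-linear bijection $Q:\mathcal S_\delta\to\mathcal D_{\lambda\mu}$ such that 1. $Q$ preserves the principal symbol: for all $k\in\frac{\mathbb N}{2}$ and $S\in\mathcal S^k_\delta$, one has $Q(S)\in\mathcal D^k_{\lambda\mu}$ and the class of $Q(S)$ in $\mathcal S^k_\delta$ is $S$; 2. $\mathcal L_{X_f}\circ Q=Q\circ L_{X_f}$ for all $X_f\in\mathfrak{spo}(2|2)$. -/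

import Mathlib

open scoped ContDiff

noncomputable section

namespace SuperContact

/-! ### Functions on the supercircle, in the affine coordinate `x` -/

/-- The smooth complex-valued functions of the affine coordinate, among all functions. -/
def smoothSubalgebra : Subalgebra ℂ (ℝ → ℂ) where
  carrier := {f | ContDiff ℝ ∞ f}
  mul_mem' {f g} (hf : ContDiff ℝ ∞ f) (hg : ContDiff ℝ ∞ g) := hf.mul hg
  add_mem' {f g} (hf : ContDiff ℝ ∞ f) (hg : ContDiff ℝ ∞ g) := hf.add hg
  algebraMap_mem' c := (contDiff_const : ContDiff ℝ ∞ fun _ : ℝ => c)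

/-- The algebra of smooth complex-valued functions of the affine coordinate, with pointwise
operations. -/
def SmoothFn : Type := smoothSubalgebra

namespace SmoothFn

instance : CommRing SmoothFn := inferInstanceAs (CommRing smoothSubalgebra)

instance : Algebra ℂ SmoothFn := inferInstanceAs (Algebra ℂ smoothSubalgebra)

instance : CoeFun SmoothFn fun _ => ℝ → ℂ := ⟨fun f => f.1⟩

@[ext]
theorem ext {f g : SmoothFn} (h : ∀ t : ℝ, f t = g t) : f = g := Subtype.ext (funext h)

theorem contDiff (f : SmoothFn) : ContDiff ℝ ∞ (f : ℝ → ℂ) := f.2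

theorem differentiable (f : SmoothFn) : Differentiable ℝ (f : ℝ → ℂ) :=
  f.contDiff.differentiable (by simp)

end SmoothFn

/-- The derivative `d/dx` of smooth functions. -/
def dx : SmoothFn →ₗ[ℂ] SmoothFn where
  toFun f := ⟨deriv (f : ℝ → ℂ), (contDiff_infty_iff_deriv.1 f.contDiff).2⟩
  map_add' f g := by
    ext t
    exact deriv_add (f.differentiable t) (g.differentiable t)
  map_smul' c f := by
    ext t
    exact deriv_const_smul c (f.differentiable t)

theorem dx_mul (f g : SmoothFn) : dx (f * g) = dx f * g + f * dx g := by
  ext t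
  exact deriv_mul (f.differentiable t) (g.differentiable t)

/-- The affine coordinate `x`, as a smooth function. -/
def xFn : SmoothFn :=
  ⟨fun t : ℝ => (t : ℂ), show ContDiff ℝ ∞ fun t : ℝ => (t : ℂ) from Complex.ofRealCLM.contDiff⟩

/-- Functions on the supercircle: `f₀(x) + θ₁ f₁(x) + θ₂ f₂(x) + θ₁ θ₂ f₁₂(x)`. -/
@[ext]
structure SuperFn where
  f0 : SmoothFn
  f1 : SmoothFn
  f2 : SmoothFn
  f12 : SmoothFn

namespace SuperFn

instance : Zero SuperFn := ⟨⟨0, 0, 0, 0⟩⟩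
instance : Add SuperFn := ⟨fun f g => ⟨f.f0 + g.f0, f.f1 + g.f1, f.f2 + g.f2, f.f12 + g.f12⟩⟩
instance : Neg SuperFn := ⟨fun f => ⟨-f.f0, -f.f1, -f.f2, -f.f12⟩⟩
instance : SMul ℂ SuperFn := ⟨fun c f => ⟨c • f.f0, c • f.f1, c • f.f2, c • f.f12⟩⟩

@[simp] theorem zero_f0 : (0 : SuperFn).f0 = 0 := rfl
@[simp] theorem zero_f1 : (0 : SuperFn).f1 = 0 := rfl
@[simp] theorem zero_f2 : (0 : SuperFn).f2 = 0 := rfl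
@[simp] theorem zero_f12 : (0 : SuperFn).f12 = 0 := rfl
@[simp] theorem add_f0 (f g : SuperFn) : (f + g).f0 = f.f0 + g.f0 := rfl
@[simp] theorem add_f1 (f g : SuperFn) : (f + g).f1 = f.f1 + g.f1 := rfl
@[simp] theorem add_f2 (f g : SuperFn) : (f + g).f2 = f.f2 + g.f2 := rfl
@[simp] theorem add_f12 (f g : SuperFn) : (f + g).f12 = f.f12 + g.f12 := rfl
@[simp] theorem neg_f0 (f : SuperFn) : (-f).f0 = -f.f0 := rfl
@[simp] theorem neg_f1 (f : SuperFn) : (-f).f1 = -f.f1 := rfl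
@[simp] theorem neg_f2 (f : SuperFn) : (-f).f2 = -f.f2 := rfl
@[simp] theorem neg_f12 (f : SuperFn) : (-f).f12 = -f.f12 := rfl
@[simp] theorem smul_f0 (c : ℂ) (f : SuperFn) : (c • f).f0 = c • f.f0 := rfl
@[simp] theorem smul_f1 (c : ℂ) (f : SuperFn) : (c • f).f1 = c • f.f1 := rfl
@[simp] theorem smul_f2 (c : ℂ) (f : SuperFn) : (c • f).f2 = c • f.f2 := rfl
@[simp] theorem smul_f12 (c : ℂ) (f : SuperFn) : (c • f).f12 = c • f.f12 := rfl

instance : AddCommGroup SuperFn where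
  add_assoc f g h := by ext1 <;> simp [add_assoc]
  zero_add f := by ext1 <;> simp
  add_zero f := by ext1 <;> simp
  add_comm f g := by ext1 <;> simp [add_comm]
  neg_add_cancel f := by ext1 <;> simp
  nsmul := nsmulRec
  zsmul := zsmulRec

instance : Module ℂ SuperFn where
  one_smul f := by ext1 <;> simp
  mul_smul a b f := by ext1 <;> simp [mul_smul]
  smul_zero a := by ext1 <;> simp
  smul_add a f g := by ext1 <;> simp
  add_smul a b f := by ext1 <;> simp [add_smul]
  zero_smul f := by ext1 <;> simp

@[simp] theorem sub_f0 (f g : SuperFn) : (f - g).f0 = f.f0 - g.f0 := by simp [sub_eq_add_neg]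
@[simp] theorem sub_f1 (f g : SuperFn) : (f - g).f1 = f.f1 - g.f1 := by simp [sub_eq_add_neg]
@[simp] theorem sub_f2 (f g : SuperFn) : (f - g).f2 = f.f2 - g.f2 := by simp [sub_eq_add_neg]
@[simp] theorem sub_f12 (f g : SuperFn) : (f - g).f12 = f.f12 - g.f12 := by
  simp [sub_eq_add_neg]

/-- The graded commutative product, determined by `θ₁² = θ₂² = 0` and `θ₂ θ₁ = - θ₁ θ₂`. -/
instance : Mul SuperFn :=
  ⟨fun f g =>
    ⟨f.f0 * g.f0,
      f.f0 * g.f1 + f.f1 * g.f0,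
      f.f0 * g.f2 + f.f2 * g.f0,
      f.f0 * g.f12 + f.f1 * g.f2 - f.f2 * g.f1 + f.f12 * g.f0⟩⟩

@[simp] theorem mul_f0 (f g : SuperFn) : (f * g).f0 = f.f0 * g.f0 := rfl
@[simp] theorem mul_f1 (f g : SuperFn) : (f * g).f1 = f.f0 * g.f1 + f.f1 * g.f0 := rfl
@[simp] theorem mul_f2 (f g : SuperFn) : (f * g).f2 = f.f0 * g.f2 + f.f2 * g.f0 := rfl
@[simp] theorem mul_f12 (f g : SuperFn) :
    (f * g).f12 = f.f0 * g.f12 + f.f1 * g.f2 - f.f2 * g.f1 + f.f12 * g.f0 := rfl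

/-- The constant function `1`. -/
instance : One SuperFn := ⟨⟨1, 0, 0, 0⟩⟩

/-- The even coordinate `x`. -/
def x : SuperFn := ⟨xFn, 0, 0, 0⟩

/-- The odd coordinate `θ₁`. -/
def θ₁ : SuperFn := ⟨0, 1, 0, 0⟩

/-- The odd coordinate `θ₂`. -/
def θ₂ : SuperFn := ⟨0, 0, 1, 0⟩

end SuperFn

/-! ### Linear operators on superfunctions -/

/-- Linear operators on the space of functions on the supercircle. -/
abbrev Op : Type := Module.End ℂ SuperFn

/-- Left multiplication by a function. -/
def mulL : SuperFn →ₗ[ℂ] Op :=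
  LinearMap.mk₂ ℂ (fun f g => f * g)
    (fun f g h => by ext1 <;> simp <;> ring)
    (fun c f g => by ext1 <;> simp [smul_add, smul_sub])
    (fun f g h => by ext1 <;> simp <;> ring)
    (fun c f g => by ext1 <;> simp [smul_add, smul_sub])

@[simp] theorem mulL_apply (f g : SuperFn) : mulL f g = f * g := rfl

/-- The even component `f₀ + θ₁ θ₂ f₁₂` of a function. -/
def evenPart : SuperFn →ₗ[ℂ] SuperFn where
  toFun f := ⟨f.f0, 0, 0, f.f12⟩
  map_add' f g := by ext1 <;> simp
  map_smul' c f := by ext1 <;> simp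

/-- The odd component `θ₁ f₁ + θ₂ f₂` of a function. -/
def oddPart : SuperFn →ₗ[ℂ] SuperFn where
  toFun f := ⟨0, f.f1, f.f2, 0⟩
  map_add' f g := by ext1 <;> simp
  map_smul' c f := by ext1 <;> simp

/-- The parity involution `f ↦ (-1)^|f| f`. -/
def parity : Op where
  toFun f := ⟨f.f0, -f.f1, -f.f2, f.f12⟩
  map_add' f g := by ext1 <;> simp [add_comm]
  map_smul' c f := by ext1 <;> simp

/-- The even vector field `∂/∂x`. -/
def pdx : Op where
  toFun f := ⟨dx f.f0, dx f.f1, dx f.f2, dx f.f12⟩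
  map_add' f g := by ext1 <;> simp
  map_smul' c f := by ext1 <;> simp

/-- The odd vector field `∂/∂θ₁` (left derivative). -/
def pdθ₁ : Op where
  toFun f := ⟨f.f1, 0, f.f12, 0⟩
  map_add' f g := by ext1 <;> simp
  map_smul' c f := by ext1 <;> simp

/-- The odd vector field `∂/∂θ₂` (left derivative). -/
def pdθ₂ : Op where
  toFun f := ⟨f.f2, -f.f12, 0, 0⟩
  map_add' f g := by ext1 <;> simp [add_comm]
  map_smul' c f := by ext1 <;> simp

/-- The generator `D̄₁ = ∂/∂θ₁ - θ₁ ∂/∂x` of the contact distribution. -/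
def D₁ : Op := pdθ₁ - mulL SuperFn.θ₁ * pdx

/-- The generator `D̄₂ = ∂/∂θ₂ - θ₂ ∂/∂x` of the contact distribution. -/
def D₂ : Op := pdθ₂ - mulL SuperFn.θ₂ * pdx

section components
variable (f : SuperFn)

@[simp] theorem evenPart_f0 : (evenPart f).f0 = f.f0 := rfl
@[simp] theorem evenPart_f1 : (evenPart f).f1 = 0 := rfl
@[simp] theorem evenPart_f2 : (evenPart f).f2 = 0 := rfl
@[simp] theorem evenPart_f12 : (evenPart f).f12 = f.f12 := rfl
@[simp] theorem oddPart_f0 : (oddPart f).f0 = 0 := rfl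
@[simp] theorem oddPart_f1 : (oddPart f).f1 = f.f1 := rfl
@[simp] theorem oddPart_f2 : (oddPart f).f2 = f.f2 := rfl
@[simp] theorem oddPart_f12 : (oddPart f).f12 = 0 := rfl
@[simp] theorem parity_f0 : (parity f).f0 = f.f0 := rfl
@[simp] theorem parity_f1 : (parity f).f1 = -f.f1 := rfl
@[simp] theorem parity_f2 : (parity f).f2 = -f.f2 := rfl
@[simp] theorem parity_f12 : (parity f).f12 = f.f12 := rfl
@[simp] theorem pdx_f0 : (pdx f).f0 = dx f.f0 := rfl
@[simp] theorem pdx_f1 : (pdx f).f1 = dx f.f1 := rfl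
@[simp] theorem pdx_f2 : (pdx f).f2 = dx f.f2 := rfl
@[simp] theorem pdx_f12 : (pdx f).f12 = dx f.f12 := rfl
@[simp] theorem D₁_f0 : (D₁ f).f0 = f.f1 := by simp [D₁, pdθ₁, SuperFn.θ₁]
@[simp] theorem D₁_f1 : (D₁ f).f1 = -dx f.f0 := by simp [D₁, pdθ₁, SuperFn.θ₁]
@[simp] theorem D₁_f2 : (D₁ f).f2 = f.f12 := by simp [D₁, pdθ₁, SuperFn.θ₁]
@[simp] theorem D₁_f12 : (D₁ f).f12 = -dx f.f2 := by simp [D₁, pdθ₁, SuperFn.θ₁]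
@[simp] theorem D₂_f0 : (D₂ f).f0 = f.f2 := by simp [D₂, pdθ₂, SuperFn.θ₂]
@[simp] theorem D₂_f1 : (D₂ f).f1 = -f.f12 := by simp [D₂, pdθ₂, SuperFn.θ₂]
@[simp] theorem D₂_f2 : (D₂ f).f2 = -dx f.f0 := by simp [D₂, pdθ₂, SuperFn.θ₂]
@[simp] theorem D₂_f12 : (D₂ f).f12 = dx f.f1 := by simp [D₂, pdθ₂, SuperFn.θ₂]

end components

/-! ### Contact vector fields, densities, differential operators -/

/-- The contact vector field with Hamiltonian `f`. For homogeneous `f` it is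
`X_f = f ∂_x - (-1)^|f| ½ (D̄₁(f) D̄₁ + D̄₂(f) D̄₂)`, and it is extended linearly to all `f`. -/
def contactField (f : SuperFn) : Op :=
  mulL f * pdx -
    (1 / 2 : ℂ) • (mulL (D₁ (parity f)) * D₁ + mulL (D₂ (parity f)) * D₂)

/-- The action `L^lam_{X_f} = X_f + lam f'` on densities of weight `lam`. -/
def lieDensity (lam : ℂ) (f : SuperFn) : Op :=
  contactField f + lam • mulL (pdx f)

/-- The operator `(-1)^|D| D`, extended linearly to all operators `D`: the sign is `+1` on operators
preserving the parity of functions and `-1` on operators reversing it. -/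
def opParity (D : Op) : Op := parity * D * parity

/-- The Lie derivative of an operator from `lam`-densities to `mu`-densities. For homogeneous `f`
and `D` it is `L^mu_{X_f} ∘ D - (-1)^(|f||D|) D ∘ L^lam_{X_f}`; it is extended bilinearly. -/
def lieOp (lam mu : ℂ) (f : SuperFn) : Op →ₗ[ℂ] Op where
  toFun D :=
    lieDensity mu f * D -
      (D * lieDensity lam (evenPart f) + opParity D * lieDensity lam (oddPart f))
  map_add' D E := by
    simp only [opParity, mul_add, add_mul]
    abel
  map_smul' c D := by
    simp only [opParity, mul_smul_comm, smul_mul_assoc, smul_sub, smul_add, RingHom.id_apply]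

/-- The differential operators of contact order at most `n / 2`: linear combinations of
`a ∂_x^l D̄₁^m D̄₂^p` with `l + m/2 + p/2 ≤ n/2`. -/
def diffOpOrder (n : ℕ) : Submodule ℂ Op :=
  Submodule.span ℂ
    {T | ∃ (a : SuperFn) (l m p : ℕ), 2 * l + m + p ≤ n ∧
      T = mulL a * pdx ^ l * D₁ ^ m * D₂ ^ p}

/-- The space of all differential operators between densities. -/
def diffOp : Submodule ℂ Op := ⨆ n, diffOpOrder n

/-! ### The action preserves the filtration -/

section filtration

theorem diffOpOrder_mono {n m : ℕ} (h : n ≤ m) : diffOpOrder n ≤ diffOpOrder m := by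
  refine Submodule.span_mono ?_
  rintro T ⟨a, l, i, j, hle, rfl⟩
  exact ⟨a, l, i, j, hle.trans h, rfl⟩

theorem diffOpOrder_le_diffOp (n : ℕ) : diffOpOrder n ≤ diffOp := le_iSup diffOpOrder n

theorem monomial_mem (a : SuperFn) {l m p n : ℕ} (h : 2 * l + m + p ≤ n) :
    mulL a * pdx ^ l * D₁ ^ m * D₂ ^ p ∈ diffOpOrder n :=
  Submodule.subset_span ⟨a, l, m, p, h, rfl⟩

theorem mulL_mul (a b : SuperFn) : mulL a * mulL b = mulL (a * b) := by
  ext1 g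
  ext1 <;> simp <;> ring

theorem mulL_one : mulL 1 = 1 := by
  have h0 : (1 : SuperFn).f0 = 1 := rfl
  have h1 : (1 : SuperFn).f1 = 0 := rfl
  have h2 : (1 : SuperFn).f2 = 0 := rfl
  have h3 : (1 : SuperFn).f12 = 0 := rfl
  ext1 g
  ext1 <;> simp [h0, h1, h2, h3]

theorem pdx_mulL (a : SuperFn) : pdx * mulL a = mulL (pdx a) + mulL a * pdx := by
  ext1 g
  ext1 <;> simp [dx_mul] <;> ring

theorem D₁_mulL (a : SuperFn) : D₁ * mulL a = mulL (D₁ a) + mulL (parity a) * D₁ := by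
  ext1 g
  ext1 <;> simp [dx_mul] <;> ring

theorem D₂_mulL (a : SuperFn) : D₂ * mulL a = mulL (D₂ a) + mulL (parity a) * D₂ := by
  ext1 g
  ext1 <;> simp [dx_mul] <;> ring

theorem D₁_pdx : D₁ * pdx = pdx * D₁ := by
  ext1 g
  ext1 <;> simp

theorem D₂_pdx : D₂ * pdx = pdx * D₂ := by
  ext1 g
  ext1 <;> simp

theorem D₂_D₁ : D₂ * D₁ = -(D₁ * D₂) := by
  ext1 g
  ext1 <;> simp

theorem D₂_D₁_pow (m : ℕ) : D₂ * D₁ ^ m = ((-1 : ℂ) ^ m) • (D₁ ^ m * D₂) := by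
  induction m with
  | zero => simp
  | succ m ih =>
    rw [pow_succ, ← mul_assoc, ih, smul_mul_assoc, mul_assoc, D₂_D₁, pow_succ (-1 : ℂ), mul_smul,
      neg_one_smul, mul_neg, mul_assoc]

theorem opParity_mul (D E : Op) : opParity (D * E) = opParity D * opParity E := by
  have h : parity * parity = 1 := by
    ext1 g
    ext1 <;> simp
  calc parity * (D * E) * parity = parity * D * 1 * E * parity := by simp only [mul_assoc, mul_one]
    _ = _ := by simp only [← h, opParity, mul_assoc]

theorem mulL_mul_mem (a : SuperFn) {n : ℕ} {T : Op} (hT : T ∈ diffOpOrder n) :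
    mulL a * T ∈ diffOpOrder n := by
  induction hT using Submodule.span_induction with
  | mem T h =>
    obtain ⟨b, l, m, p, h, rfl⟩ := h
    simp only [← mul_assoc, mulL_mul]
    exact monomial_mem _ h
  | zero => simp
  | add S T _ _ hS hT => rw [mul_add]; exact add_mem hS hT
  | smul c T _ hT => rw [mul_smul_comm]; exact Submodule.smul_mem _ _ hT

theorem pdx_mul_mem {n : ℕ} {T : Op} (hT : T ∈ diffOpOrder n) :
    pdx * T ∈ diffOpOrder (n + 2) := by
  induction hT using Submodule.span_induction with
  | mem T h =>
    obtain ⟨b, l, m, p, h, rfl⟩ := h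
    have : pdx * (mulL b * pdx ^ l * D₁ ^ m * D₂ ^ p) =
        mulL (pdx b) * pdx ^ l * D₁ ^ m * D₂ ^ p +
          mulL b * pdx ^ (l + 1) * D₁ ^ m * D₂ ^ p := by
      simp only [← mul_assoc, pdx_mulL, add_mul, pow_succ' pdx l]
    rw [this]
    exact add_mem (monomial_mem _ (by omega)) (monomial_mem _ (by omega))
  | zero => simp
  | add S T _ _ hS hT => rw [mul_add]; exact add_mem hS hT
  | smul c T _ hT => rw [mul_smul_comm]; exact Submodule.smul_mem _ _ hT

theorem D₁_mul_mem {n : ℕ} {T : Op} (hT : T ∈ diffOpOrder n) :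
    D₁ * T ∈ diffOpOrder (n + 1) := by
  induction hT using Submodule.span_induction with
  | mem T h =>
    obtain ⟨b, l, m, p, h, rfl⟩ := h
    have hc : D₁ * pdx ^ l = pdx ^ l * D₁ :=
      ((show Commute D₁ pdx from D₁_pdx).pow_right l).eq
    have : D₁ * (mulL b * pdx ^ l * D₁ ^ m * D₂ ^ p) =
        mulL (D₁ b) * pdx ^ l * D₁ ^ m * D₂ ^ p +
          mulL (parity b) * pdx ^ l * D₁ ^ (m + 1) * D₂ ^ p := by
      simp only [← mul_assoc, D₁_mulL, add_mul, pow_succ' D₁ m]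
      simp only [mul_assoc (mulL (parity b)), hc]
    rw [this]
    exact add_mem (monomial_mem _ (by omega)) (monomial_mem _ (by omega))
  | zero => simp
  | add S T _ _ hS hT => rw [mul_add]; exact add_mem hS hT
  | smul c T _ hT => rw [mul_smul_comm]; exact Submodule.smul_mem _ _ hT

theorem D₂_mul_mem {n : ℕ} {T : Op} (hT : T ∈ diffOpOrder n) :
    D₂ * T ∈ diffOpOrder (n + 1) := by
  induction hT using Submodule.span_induction with
  | mem T h =>
    obtain ⟨b, l, m, p, h, rfl⟩ := h
    have hc : D₂ * pdx ^ l = pdx ^ l * D₂ :=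
      ((show Commute D₂ pdx from D₂_pdx).pow_right l).eq
    have : D₂ * (mulL b * pdx ^ l * D₁ ^ m * D₂ ^ p) =
        mulL (D₂ b) * pdx ^ l * D₁ ^ m * D₂ ^ p +
          ((-1 : ℂ) ^ m) • (mulL (parity b) * pdx ^ l * D₁ ^ m * D₂ ^ (p + 1)) := by
      have e1 : mulL (parity b) * D₂ * pdx ^ l * D₁ ^ m * D₂ ^ p =
          mulL (parity b) * pdx ^ l * (D₂ * D₁ ^ m) * D₂ ^ p := by
        rw [mul_assoc (mulL (parity b)), hc]
        simp only [mul_assoc]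
      rw [← mul_assoc, ← mul_assoc, ← mul_assoc, D₂_mulL, add_mul, add_mul, add_mul, e1,
        D₂_D₁_pow]
      simp only [mul_smul_comm, smul_mul_assoc, mul_assoc, pow_succ' D₂ p]
    rw [this]
    exact add_mem (monomial_mem _ (by omega))
      (Submodule.smul_mem _ _ (monomial_mem _ (by omega)))
  | zero => simp
  | add S T _ _ hS hT => rw [mul_add]; exact add_mem hS hT
  | smul c T _ hT => rw [mul_smul_comm]; exact Submodule.smul_mem _ _ hT

theorem pow_mul_mem {E : Op} {d : ℕ}
    (hE : ∀ {n : ℕ} {T : Op}, T ∈ diffOpOrder n → E * T ∈ diffOpOrder (n + d))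
    (l : ℕ) {n : ℕ} {T : Op} (hT : T ∈ diffOpOrder n) : E ^ l * T ∈ diffOpOrder (n + d * l) := by
  induction l with
  | zero => simpa using hT
  | succ l ih =>
    rw [pow_succ', mul_assoc, Nat.mul_succ, ← Nat.add_assoc]
    exact hE ih

theorem mul_mem_order {n m : ℕ} {S T : Op} (hS : S ∈ diffOpOrder n) (hT : T ∈ diffOpOrder m) :
    S * T ∈ diffOpOrder (n + m) := by
  induction hS using Submodule.span_induction with
  | mem S h =>
    obtain ⟨b, l, i, j, h, rfl⟩ := h
    simp only [mul_assoc]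
    exact diffOpOrder_mono (by omega) (mulL_mul_mem b
      (pow_mul_mem pdx_mul_mem l (pow_mul_mem D₁_mul_mem i (pow_mul_mem D₂_mul_mem j hT))))
  | zero => simp
  | add A B _ _ hA hB => rw [add_mul]; exact add_mem hA hB
  | smul c A _ hA => rw [smul_mul_assoc]; exact Submodule.smul_mem _ _ hA

theorem mulL_mem (a : SuperFn) (n : ℕ) : mulL a ∈ diffOpOrder n := by
  simpa using monomial_mem a (l := 0) (m := 0) (p := 0) (n := n) (by omega)

theorem one_mem (n : ℕ) : (1 : Op) ∈ diffOpOrder n := by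
  rw [← mulL_one]
  exact mulL_mem 1 n

theorem pdx_mem : pdx ∈ diffOpOrder 2 := by simpa using pdx_mul_mem (one_mem 0)
theorem D₁_mem : D₁ ∈ diffOpOrder 1 := by simpa using D₁_mul_mem (one_mem 0)
theorem D₂_mem : D₂ ∈ diffOpOrder 1 := by simpa using D₂_mul_mem (one_mem 0)

theorem contactField_mem (f : SuperFn) : contactField f ∈ diffOpOrder 2 :=
  sub_mem (mulL_mul_mem _ pdx_mem)
    (Submodule.smul_mem _ _ (add_mem (mulL_mul_mem _ (diffOpOrder_mono (by omega) D₁_mem))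
      (mulL_mul_mem _ (diffOpOrder_mono (by omega) D₂_mem))))

/-- The graded commutator with a contact vector field. -/
def fieldBracket (f : SuperFn) (D : Op) : Op :=
  contactField f * D -
    (D * contactField (evenPart f) + opParity D * contactField (oddPart f))

theorem contactField_add (f g : SuperFn) :
    contactField (f + g) = contactField f + contactField g := by
  simp only [contactField, map_add, add_mul, smul_add]
  abel

theorem even_add_odd (f : SuperFn) : evenPart f + oddPart f = f := by
  ext1 <;> simp

theorem contactField_split (f : SuperFn) :
    contactField f = contactField (evenPart f) + contactField (oddPart f) := by
  rw [← contactField_add, even_add_odd]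

theorem fieldBracket_mul (f : SuperFn) (D E : Op) :
    fieldBracket f (D * E) =
      fieldBracket f D * E + D * fieldBracket (evenPart f) E +
        opParity D * fieldBracket (oddPart f) E := by
  have e1 : evenPart (evenPart f) = evenPart f := by ext1 <;> simp
  have e2 : oddPart (evenPart f) = 0 := by ext1 <;> simp
  have e3 : evenPart (oddPart f) = 0 := by ext1 <;> simp
  have e4 : oddPart (oddPart f) = oddPart f := by ext1 <;> simp
  have e5 : contactField 0 = 0 := by simp [contactField]
  simp only [fieldBracket, opParity_mul, e1, e2, e3, e4, e5]
  noncomm_ring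

/-- The constant function `1/2`. -/
def half : SmoothFn := algebraMap ℂ SmoothFn (1 / 2)

theorem half_add_half : half + half = 1 := by
  rw [half, ← map_add]
  norm_num

theorem half_smul (g : SmoothFn) : (1 / 2 : ℂ) • g = half * g := Algebra.smul_def _ _

theorem dx_algebraMap (c : ℂ) : dx (algebraMap ℂ SmoothFn c) = 0 := by
  ext t
  exact deriv_const t c

theorem dx_half : dx half = 0 := dx_algebraMap _

theorem dx_two : dx 2 = 0 := by
  have h := dx_algebraMap 2
  rwa [map_ofNat] at h

theorem contactField_f0 (f g : SuperFn) :
    (contactField f g).f0 = f.f0 * dx g.f0 + half * (f.f1 * g.f1 + f.f2 * g.f2) := by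
  simp [contactField, -one_div, half_smul]
  ring

theorem contactField_f1 (f g : SuperFn) :
    (contactField f g).f1 = f.f0 * dx g.f1 + f.f1 * dx g.f0 -
      half * (f.f1 * dx g.f0 - dx f.f0 * g.f1 + f.f2 * g.f12 - f.f12 * g.f2) := by
  simp [contactField, -one_div, half_smul]
  ring

theorem contactField_f2 (f g : SuperFn) :
    (contactField f g).f2 = f.f0 * dx g.f2 + f.f2 * dx g.f0 -
      half * (f.f2 * dx g.f0 - dx f.f0 * g.f2 - f.f1 * g.f12 + f.f12 * g.f1) := by
  simp [contactField, -one_div, half_smul]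
  ring

theorem contactField_f12 (f g : SuperFn) :
    (contactField f g).f12 =
      f.f0 * dx g.f12 + f.f1 * dx g.f2 - f.f2 * dx g.f1 + f.f12 * dx g.f0 -
        half * (f.f1 * dx g.f2 + dx f.f2 * g.f1 - f.f2 * dx g.f1 - dx f.f1 * g.f2 +
          2 * (f.f12 * dx g.f0) - 2 * (dx f.f0 * g.f12)) := by
  simp [contactField, -one_div, half_smul]
  ring

theorem fieldBracket_apply (f : SuperFn) (D : Op) (g : SuperFn) :
    fieldBracket f D g = contactField f (D g) - (D (contactField (evenPart f) g) +
      parity (D (parity (contactField (oddPart f) g)))) := rfl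

theorem fieldBracket_mulL (f a : SuperFn) :
    fieldBracket f (mulL a) = mulL (contactField f a) := by
  ext1 g
  rw [fieldBracket_apply]
  ext1 <;> simp [contactField_f0, contactField_f1, contactField_f2, contactField_f12, dx_mul] <;>
    ring

theorem fieldBracket_pdx (f : SuperFn) :
    fieldBracket f pdx = -contactField (pdx f) := by
  ext1 g
  rw [fieldBracket_apply]
  ext1 <;> simp [contactField_f0, contactField_f1, contactField_f2, contactField_f12, dx_mul,
    dx_half, dx_two] <;> ring

/-- Contact vector fields preserve the contact distribution. -/
theorem fieldBracket_D₁ (f : SuperFn) :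
    fieldBracket f D₁ =
      (1 / 2 : ℂ) • (mulL (D₁ (D₂ f)) * D₂) - (1 / 2 : ℂ) • (mulL (pdx f) * D₁) := by
  have hc := half_add_half
  ext1 g
  rw [fieldBracket_apply]
  ext1 <;> simp [contactField_f0, contactField_f1, contactField_f2, contactField_f12, dx_mul,
    dx_half, -one_div, half_smul] <;> grind

theorem fieldBracket_D₂ (f : SuperFn) :
    fieldBracket f D₂ =
      -((1 / 2 : ℂ) • (mulL (D₁ (D₂ f)) * D₁)) - (1 / 2 : ℂ) • (mulL (pdx f) * D₂) := by
  have hc := half_add_half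
  ext1 g
  rw [fieldBracket_apply]
  ext1 <;> simp [contactField_f0, contactField_f1, contactField_f2, contactField_f12, dx_mul,
    dx_half, -one_div, half_smul] <;> grind

theorem opParity_mem {n : ℕ} {T : Op} (hT : T ∈ diffOpOrder n) :
    opParity T ∈ diffOpOrder n := by
  have hm (a : SuperFn) : opParity (mulL a) = mulL (parity a) := by
    ext1 g
    ext1 <;> simp [opParity] <;> ring
  have hx : opParity pdx = pdx := by
    ext1 g
    ext1 <;> simp [opParity]
  have h1 : opParity D₁ = (-1 : ℂ) • D₁ := by
    ext1 g
    ext1 <;> simp [opParity]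
  have h2 : opParity D₂ = (-1 : ℂ) • D₂ := by
    ext1 g
    ext1 <;> simp [opParity]
  have ho : opParity 1 = 1 := by
    ext1 g
    ext1 <;> simp [opParity]
  have hp (E : Op) (k : ℕ) : opParity (E ^ k) = opParity E ^ k := by
    induction k with
    | zero => simpa using ho
    | succ k ih => rw [pow_succ, opParity_mul, ih, pow_succ]
  induction hT using Submodule.span_induction with
  | mem T h =>
    obtain ⟨b, l, m, p, h, rfl⟩ := h
    simp only [opParity_mul, hp, hm, hx, h1, h2, smul_pow, mul_smul_comm, smul_mul_assoc]
    exact Submodule.smul_mem _ _ (Submodule.smul_mem _ _ (monomial_mem _ h))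
  | zero => simp [opParity]
  | add A B _ _ hA hB =>
    have : opParity (A + B) = opParity A + opParity B := by simp only [opParity, mul_add, add_mul]
    rw [this]
    exact add_mem hA hB
  | smul c A _ hA =>
    have : opParity (c • A) = c • opParity A := by
      simp only [opParity, mul_smul_comm, smul_mul_assoc]
    rw [this]
    exact Submodule.smul_mem _ _ hA

/-- Auxiliary: `D` has order at most `n / 2`, and so have all its brackets with contact fields. -/
def Stable (n : ℕ) (D : Op) : Prop :=
  D ∈ diffOpOrder n ∧ ∀ f, fieldBracket f D ∈ diffOpOrder n

theorem Stable.mul {n m : ℕ} {D E : Op} (hD : Stable n D) (hE : Stable m E) :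
    Stable (n + m) (D * E) := by
  refine ⟨mul_mem_order hD.1 hE.1, fun f => ?_⟩
  rw [fieldBracket_mul]
  exact add_mem (add_mem (mul_mem_order (hD.2 f) hE.1) (mul_mem_order hD.1 (hE.2 _)))
    (mul_mem_order (opParity_mem hD.1) (hE.2 _))

theorem Stable.pow {n : ℕ} {D : Op} (hD : Stable n D) (k : ℕ) : Stable (n * k) (D ^ k) := by
  induction k with
  | zero =>
    refine ⟨one_mem _, fun f => ?_⟩
    rw [pow_zero, ← mulL_one, fieldBracket_mulL]
    exact mulL_mem _ _
  | succ k ih =>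
    rw [pow_succ, Nat.mul_succ]
    exact ih.mul hD

theorem stable_of_mem {n : ℕ} {D : Op} (hD : D ∈ diffOpOrder n) : Stable n D := by
  refine ⟨hD, fun f => ?_⟩
  induction hD using Submodule.span_induction with
  | mem T h =>
    obtain ⟨b, l, m, p, h, rfl⟩ := h
    have hb : Stable 0 (mulL b) :=
      ⟨mulL_mem _ _, fun f => by rw [fieldBracket_mulL]; exact mulL_mem _ _⟩
    have hx : Stable 2 pdx :=
      ⟨pdx_mem, fun f => by rw [fieldBracket_pdx]; exact neg_mem (contactField_mem _)⟩
    have h1 : Stable 1 D₁ := ⟨D₁_mem, fun f => by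
      rw [fieldBracket_D₁]
      exact sub_mem (Submodule.smul_mem _ _ (mulL_mul_mem _ D₂_mem))
        (Submodule.smul_mem _ _ (mulL_mul_mem _ D₁_mem))⟩
    have h2 : Stable 1 D₂ := ⟨D₂_mem, fun f => by
      rw [fieldBracket_D₂]
      exact sub_mem (neg_mem (Submodule.smul_mem _ _ (mulL_mul_mem _ D₁_mem)))
        (Submodule.smul_mem _ _ (mulL_mul_mem _ D₂_mem))⟩
    exact diffOpOrder_mono (by omega)
      ((((hb.mul (hx.pow l)).mul (h1.pow m)).mul (h2.pow p)).2 f)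
  | zero => simp [fieldBracket, opParity]
  | add A B _ _ hA hB =>
    have : fieldBracket f (A + B) = fieldBracket f A + fieldBracket f B := by
      simp only [fieldBracket, opParity]
      noncomm_ring
    rw [this]
    exact add_mem hA hB
  | smul c A _ hA =>
    have : fieldBracket f (c • A) = c • fieldBracket f A := by
      simp only [fieldBracket, opParity, mul_smul_comm, smul_mul_assoc, smul_sub, smul_add]
    rw [this]
    exact Submodule.smul_mem _ _ hA

/-- The action of contact vector fields preserves the order of differential operators. -/
theorem lieOp_mem (lam mu : ℂ) (f : SuperFn) {n : ℕ} {D : Op} (hD : D ∈ diffOpOrder n) :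
    lieOp lam mu f D ∈ diffOpOrder n := by
  have e : lieOp lam mu f D = fieldBracket f D + mu • (mulL (pdx f) * D) -
      lam • (D * mulL (pdx (evenPart f)) + opParity D * mulL (pdx (oddPart f))) := by
    simp only [lieOp, LinearMap.coe_mk, AddHom.coe_mk, lieDensity, fieldBracket, mul_add, add_mul,
      smul_mul_assoc, mul_smul_comm, smul_add]
    abel
  rw [e]
  exact sub_mem (add_mem ((stable_of_mem hD).2 f) (Submodule.smul_mem _ _ (mulL_mul_mem _ hD)))
    (Submodule.smul_mem _ _ (add_mem (mul_mem_order (m := 0) hD (mulL_mem _ _))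
      (mul_mem_order (m := 0) (opParity_mem hD) (mulL_mem _ _))))

theorem lieOp_mem_diffOp (lam mu : ℂ) (f : SuperFn) {D : Op} (hD : D ∈ diffOp) :
    lieOp lam mu f D ∈ diffOp := by
  have h : diffOp ≤ diffOp.comap (lieOp lam mu f) :=
    iSup_le fun n _ hD => diffOpOrder_le_diffOp n (lieOp_mem lam mu f hD)
  exact h hD

end filtration

/-! ### Modules of differential operators and of symbols -/

/-- The Lie derivative on the module `𝒟_{lam, mu}` of differential operators from densities of
weight `lam` to densities of weight `mu`. -/
def lieDiffOp (lam mu : ℂ) (f : SuperFn) : diffOp →ₗ[ℂ] diffOp :=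
  (lieOp lam mu f).restrict fun _ hD => lieOp_mem_diffOp lam mu f hD

/-- The Lie derivative on the differential operators of order at most `n / 2`. -/
def lieOrder (lam mu : ℂ) (f : SuperFn) (n : ℕ) : diffOpOrder n →ₗ[ℂ] diffOpOrder n :=
  (lieOp lam mu f).restrict fun _ hD => lieOp_mem lam mu f hD

/-- Inside the operators of order at most `n / 2`, those of order at most `(n - 1) / 2`
(only `0` if `n = 0`). -/
def lowerOrder : (n : ℕ) → Submodule ℂ (diffOpOrder n)
  | 0 => ⊥
  | n + 1 => (diffOpOrder n).submoduleOf (diffOpOrder (n + 1))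

theorem lowerOrder_le_comap (lam mu : ℂ) (f : SuperFn) (n : ℕ) :
    lowerOrder n ≤ (lowerOrder n).comap (lieOrder lam mu f n) := by
  cases n with
  | zero =>
    intro D hD
    rw [lowerOrder, Submodule.mem_bot] at hD
    simp [hD]
  | succ n =>
    intro D hD
    exact lieOp_mem lam mu f hD

/-- The space of symbols of degree `n / 2`. -/
def Symbol (n : ℕ) : Type := diffOpOrder n ⧸ lowerOrder n

instance (n : ℕ) : AddCommGroup (Symbol n) :=
  inferInstanceAs (AddCommGroup (diffOpOrder n ⧸ lowerOrder n))

instance (n : ℕ) : Module ℂ (Symbol n) :=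
  inferInstanceAs (Module ℂ (diffOpOrder n ⧸ lowerOrder n))

/-- The principal symbol of degree `n / 2` of an operator of order at most `n / 2`. -/
def principalSymbol (n : ℕ) : diffOpOrder n →ₗ[ℂ] Symbol n := (lowerOrder n).mkQ

/-- The Lie derivative of symbols of degree `n / 2`, induced by that of differential operators. -/
def lieSymbolDeg (lam mu : ℂ) (f : SuperFn) (n : ℕ) : Symbol n →ₗ[ℂ] Symbol n :=
  (lowerOrder n).mapQ (lowerOrder n) (lieOrder lam mu f n) (lowerOrder_le_comap lam mu f n)

/-- The space of symbols, the direct sum over all degrees `n / 2`. -/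
abbrev SymbolSpace : Type := DirectSum ℕ Symbol

/-- The Lie derivative of symbols. -/
def lieSymbol (lam mu : ℂ) (f : SuperFn) : SymbolSpace →ₗ[ℂ] SymbolSpace :=
  DirectSum.lmap (lieSymbolDeg lam mu f)

/-! ### The Lie superalgebra `spo(2|2)`, quantizations, critical values -/

/-- The contact Hamiltonians of the elements of `spo(2|2)`. -/
def spoHamiltonians : Submodule ℂ SuperFn :=
  Submodule.span ℂ
    {1, SuperFn.x, SuperFn.θ₁, SuperFn.θ₂, SuperFn.θ₁ * SuperFn.θ₂,
      SuperFn.x * SuperFn.x, SuperFn.x * SuperFn.θ₁, SuperFn.x * SuperFn.θ₂}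

/-- An `spo(2|2)`-equivariant quantization: a linear bijection from symbols to differential
operators that preserves the principal symbol and commutes with the action of `spo(2|2)`. -/
structure IsEquivariantQuantization (lam mu : ℂ) (Q : SymbolSpace →ₗ[ℂ] diffOp) : Prop where
  bijective : Function.Bijective Q
  principalSymbol_eq : ∀ (n : ℕ) (S : Symbol n), ∃ D : diffOpOrder n,
    (Q (DirectSum.lof ℂ ℕ Symbol n S) : Op) = D ∧ principalSymbol n D = S
  equivariant : ∀ f ∈ spoHamiltonians,
    lieDiffOp lam mu f ∘ₗ Q = Q ∘ₗ lieSymbol lam mu f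

/-- With `k = n / 2`, the number `α_k`: it is `(δ - k)²` if `k` is an integer and `(δ - k)² - 1/4`
if `k` is half an odd integer. -/
def casimirValue (δ : ℂ) (n : ℕ) : ℂ :=
  if Even n then (δ - (n : ℂ) / 2) ^ 2 else (δ - (n : ℂ) / 2) ^ 2 - 1 / 4

/-- A value of `δ` is critical if `α_k = α_l` for some `l < k` in `ℕ/2`. -/
def IsCritical (δ : ℂ) : Prop :=
  ∃ k l : ℕ, l < k ∧ casimirValue δ k = casimirValue δ l

end SuperContact

end

/-!
The quantization is read off from the Casimir operator of `spo(2|2)`. Write `e`, `h`, `f`, `r`,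
`aᵢ`, `bᵢ` for the actions of the Hamiltonians `1`, `x`, `x²`, `θ₁θ₂`, `θᵢ`, `xθᵢ`. The element
`C = h² + r² - e f + 2 (a₁ b₁ + a₂ b₂)` commutes with all of them
(`SpoRelations.commute_casimirElement_odd`), so for the Lie derivative of operators it commutes with
the action of `spo(2|2)` (`commute_casimir_lieOp`).

Modulo lower order, an operator of order `n / 2` is a sum of terms `a T` where `T` is a product of
`∂_x` and of the isotropic fields `D̄₁ ± i D̄₂`. On such a term `X_g` acts through
`a ↦ X_g(a) + w g' a + q D̄₁D̄₂(g) a`, with weight `w = δ - n / 2` and charge `q = 0` if `n` is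
even, `q = ± i / 2` if `n` is odd (`lieOp_mulL_mul`). The Casimir operator of this action is the
scalar `w² + q²` (`casimir_weightAction`), which is the number `α_{n/2}`. Therefore `C - α_{n/2}`
maps operators of order `n / 2` to operators of lower order (`casimir_sub_smul_mem`).

If `δ` is not critical, the numbers `α` are distinct, and the product over `i < n` of the operators
`(C - α_{i/2}) / (α_{n/2} - α_{i/2})` kills the operators of order less than `n / 2`, keeps
principal symbols of degree `n / 2` and commutes with `spo(2|2)`. It thus induces an equivariant
lift of the symbols of degree `n / 2` (`symbolLift`), and these lifts form the quantization; bijectivity is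
automatic by triangularity (`bijective_of_principalSymbol_eq`). Conversely an equivariant `Q` intertwines the Casimir operators
of symbols and of operators, so `Q(S)` is an eigenvector of `C` for `α_{n/2}` with principal symbol
`S`; the projection fixes it, which forces it to be the lift above (`eq_casimirQuantization`).
-/

namespace SuperContact

/-! ### Contact Hamiltonians acting on densities -/

theorem opParity_add (D E : Op) : opParity (D + E) = opParity D + opParity E := by
  simp only [opParity, mul_add, add_mul]

theorem opParity_sub (D E : Op) : opParity (D - E) = opParity D - opParity E := by
  simp only [opParity, mul_sub, sub_mul]

theorem opParity_opParity (D : Op) : opParity (opParity D) = D := by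
  ext1 g
  have h (g : SuperFn) : parity (parity g) = g := by ext1 <;> simp
  simp [opParity, h]

theorem opParity_lieDensity (lam : ℂ) (f : SuperFn) :
    opParity (lieDensity lam f) = lieDensity lam (parity f) := by
  ext1 g
  ext1 <;> simp [opParity, lieDensity, contactField_f0, contactField_f1, contactField_f2,
    contactField_f12] <;> ring_nf

theorem lieDensity_add (lam : ℂ) (f g : SuperFn) :
    lieDensity lam (f + g) = lieDensity lam f + lieDensity lam g := by
  simp only [lieDensity, contactField_add, map_add, smul_add]
  abel

theorem lieDensity_smul (lam c : ℂ) (f : SuperFn) :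
    lieDensity lam (c • f) = c • lieDensity lam f := by
  simp only [lieDensity, contactField, map_smul, smul_mul_assoc, ← smul_add, smul_comm _ c,
    ← smul_sub]

/-- The contact bracket `{f, g} = X_f(g) - f' g`, for which `X_{f, g}` is the supercommutator of
`X_f` and `X_g`. -/
noncomputable def contactBracket (f g : SuperFn) : SuperFn := contactField f g - pdx f * g

/-- The supercommutator of the actions of `f` and `g` on densities of weight `lam` is the action of
their contact bracket. -/
theorem lieOp_lieDensity (lam : ℂ) (f g : SuperFn) :
    lieOp lam lam f (lieDensity lam g) = lieDensity lam (contactBracket f g) := by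
  have hc := half_add_half
  have e (g : SuperFn) : opParity (lieDensity lam g) = lieDensity lam (parity g) :=
    opParity_lieDensity lam g
  ext1 u
  simp only [lieOp, LinearMap.coe_mk, AddHom.coe_mk, e]
  ext1 <;> simp [lieDensity, contactBracket, contactField_f0, contactField_f1, contactField_f2,
    contactField_f12, dx_mul, dx_half, dx_two, Algebra.smul_def] <;> grind

/-! ### The Casimir element of `spo(2|2)` in an associative algebra -/

section

variable {A : Type*} [Ring A] [Algebra ℂ A]

/-- The commutation relations of `spo(2|2)` in an associative algebra. The letters stand for the
Hamiltonians `1`, `x`, `x²`, `θ₁θ₂`, `θ₁`, `θ₂`, `xθ₁`, `xθ₂`, in this order. Each relation rewrites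
the square of an odd letter or a product that violates the ordering
`e < a₁ < a₂ < h < r < b₁ < b₂ < f`. -/
structure SpoRelations (e h f r a₁ a₂ b₁ b₂ : A) : Prop where
  he : h * e = e * h - e
  fe : f * e = e * f - (2 : ℂ) • h
  fh : f * h = h * f - f
  re : r * e = e * r
  rh : r * h = h * r
  rf : f * r = r * f
  a₁e : a₁ * e = e * a₁
  a₂e : a₂ * e = e * a₂
  b₁e : b₁ * e = e * b₁ - a₁
  b₂e : b₂ * e = e * b₂ - a₂
  ha₁ : h * a₁ = a₁ * h - (1 / 2 : ℂ) • a₁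
  ha₂ : h * a₂ = a₂ * h - (1 / 2 : ℂ) • a₂
  hb₁ : b₁ * h = h * b₁ - (1 / 2 : ℂ) • b₁
  hb₂ : b₂ * h = h * b₂ - (1 / 2 : ℂ) • b₂
  fa₁ : f * a₁ = a₁ * f - b₁
  fa₂ : f * a₂ = a₂ * f - b₂
  fb₁ : f * b₁ = b₁ * f
  fb₂ : f * b₂ = b₂ * f
  ra₁ : r * a₁ = a₁ * r - (1 / 2 : ℂ) • a₂
  ra₂ : r * a₂ = a₂ * r + (1 / 2 : ℂ) • a₁
  rb₁ : b₁ * r = r * b₁ + (1 / 2 : ℂ) • b₂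
  rb₂ : b₂ * r = r * b₂ - (1 / 2 : ℂ) • b₁
  a₁a₁ : a₁ * a₁ = (1 / 4 : ℂ) • e
  a₂a₂ : a₂ * a₂ = (1 / 4 : ℂ) • e
  a₂a₁ : a₂ * a₁ = -(a₁ * a₂)
  b₁a₁ : b₁ * a₁ = (1 / 2 : ℂ) • h - a₁ * b₁
  b₂a₂ : b₂ * a₂ = (1 / 2 : ℂ) • h - a₂ * b₂
  b₂a₁ : b₂ * a₁ = (1 / 2 : ℂ) • r - a₁ * b₂
  b₁a₂ : b₁ * a₂ = -((1 / 2 : ℂ) • r) - a₂ * b₁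
  b₁b₁ : b₁ * b₁ = (1 / 4 : ℂ) • f
  b₂b₂ : b₂ * b₂ = (1 / 4 : ℂ) • f
  b₂b₁ : b₂ * b₁ = -(b₁ * b₂)

/-- The Casimir element of `spo(2|2)`. -/
def casimirElement (e h f r a₁ a₂ b₁ b₂ : A) : A :=
  h * h + r * r - e * f + (2 : ℂ) • (a₁ * b₁ + a₂ * b₂)

namespace SpoRelations

variable {e h f r a₁ a₂ b₁ b₂ : A} (H : SpoRelations e h f r a₁ a₂ b₁ b₂)
include H

set_option linter.unusedSimpArgs false in
/-- The Casimir element commutes with the odd generators: both sides have the same normal form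
for the ordering `e < a₁ < a₂ < h < r < b₁ < b₂ < f`. -/
theorem commute_casimirElement_odd :
    Commute (casimirElement e h f r a₁ a₂ b₁ b₂) a₁ ∧
      Commute (casimirElement e h f r a₁ a₂ b₁ b₂) a₂ ∧
      Commute (casimirElement e h f r a₁ a₂ b₁ b₂) b₁ ∧
      Commute (casimirElement e h f r a₁ a₂ b₁ b₂) b₂ := by
  obtain ⟨he, fe, fh, re, rh, rf, a₁e, a₂e, b₁e, b₂e, ha₁, ha₂, hb₁, hb₂, fa₁, fa₂, fb₁, fb₂, ra₁,
    ra₂, rb₁, rb₂, a₁a₁, a₂a₂, a₂a₁, b₁a₁, b₂a₂, b₂a₁, b₁a₂, b₁b₁, b₂b₂, b₂b₁⟩ := H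
  have k {u v w : A} (huv : u * v = w) (z : A) : u * (v * z) = w * z := by rw [← mul_assoc, huv]
  refine ⟨?_, ?_, ?_, ?_⟩ <;>
    simp only [casimirElement, Commute, SemiconjBy, mul_add, add_mul, mul_sub, sub_mul, mul_assoc,
      smul_mul_assoc, mul_smul_comm, smul_add, smul_sub, smul_smul, mul_neg, neg_mul, smul_neg,
      neg_smul,
      he, fe, fh, re, rh, rf, a₁e, a₂e, b₁e, b₂e, ha₁, ha₂, hb₁, hb₂, fa₁, fa₂, fb₁, fb₂, ra₁,
      ra₂, rb₁, rb₂, a₁a₁, a₂a₂, a₂a₁, b₁a₁, b₂a₂, b₂a₁, b₁a₂, b₁b₁, b₂b₂, b₂b₁,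
      k he, k fe, k fh, k re, k rh, k rf, k a₁e, k a₂e, k b₁e, k b₂e, k ha₁, k ha₂, k hb₁, k hb₂,
      k fa₁, k fa₂, k fb₁, k fb₂, k ra₁, k ra₂, k rb₁, k rb₂, k a₁a₁, k a₂a₂, k a₂a₁, k b₁a₁,
      k b₂a₂, k b₂a₁, k b₁a₂, k b₁b₁, k b₂b₂, k b₂b₁]
    <;> module

/-- The odd generators generate `spo(2|2)`, so the Casimir element also commutes with the even
generators. -/
theorem commute_casimirElement_even :
    Commute (casimirElement e h f r a₁ a₂ b₁ b₂) e ∧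
      Commute (casimirElement e h f r a₁ a₂ b₁ b₂) h ∧
      Commute (casimirElement e h f r a₁ a₂ b₁ b₂) f ∧
      Commute (casimirElement e h f r a₁ a₂ b₁ b₂) r := by
  obtain ⟨c₁, c₂, c₃, c₄⟩ := H.commute_casimirElement_odd
  have he : e = (4 : ℂ) • (a₁ * a₁) := by rw [H.a₁a₁]; module
  have hh : h = (2 : ℂ) • (b₁ * a₁ + a₁ * b₁) := by rw [H.b₁a₁]; module
  have hf : f = (4 : ℂ) • (b₁ * b₁) := by rw [H.b₁b₁]; module
  have hr : r = (2 : ℂ) • (b₂ * a₁ + a₁ * b₂) := by rw [H.b₂a₁]; module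
  generalize casimirElement e h f r a₁ a₂ b₁ b₂ = C at *
  refine ⟨?_, ?_, ?_, ?_⟩
  · rw [he]; exact (c₁.mul_right c₁).smul_right _
  · rw [hh]; exact ((c₃.mul_right c₁).add_right (c₁.mul_right c₃)).smul_right _
  · rw [hf]; exact (c₃.mul_right c₃).smul_right _
  · rw [hr]; exact ((c₄.mul_right c₁).add_right (c₁.mul_right c₄)).smul_right _

end SpoRelations

end

/-! ### The action on operators and its Casimir operator -/

theorem oddPart_eq_self {f : SuperFn} (hf : evenPart f = 0) : oddPart f = f := by
  simpa [hf] using even_add_odd f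

theorem evenPart_eq_self {f : SuperFn} (hf : oddPart f = 0) : evenPart f = f := by
  simpa [hf] using even_add_odd f

theorem parity_eq_self {f : SuperFn} (hf : oddPart f = 0) : parity f = f := by
  have h : parity f = evenPart f - oddPart f := by ext1 <;> simp
  rw [h, hf, evenPart_eq_self hf, sub_zero]

theorem parity_eq_neg {f : SuperFn} (hf : evenPart f = 0) : parity f = -f := by
  have h : parity f = evenPart f - oddPart f := by ext1 <;> simp
  rw [h, hf, oddPart_eq_self hf, zero_sub]

theorem lieDensity_zero (lam : ℂ) : lieDensity lam 0 = 0 := by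
  simp [lieDensity, contactField]

theorem lieOp_of_even (lam mu : ℂ) {f : SuperFn} (hf : oddPart f = 0) (D : Op) :
    lieOp lam mu f D = lieDensity mu f * D - D * lieDensity lam f := by
  simp [lieOp, hf, evenPart_eq_self hf, lieDensity_zero]

theorem lieOp_of_odd (lam mu : ℂ) {f : SuperFn} (hf : evenPart f = 0) (D : Op) :
    lieOp lam mu f D = lieDensity mu f * D - opParity D * lieDensity lam f := by
  simp [lieOp, hf, oddPart_eq_self hf, lieDensity_zero]

theorem lieDensity_mul_of_even (lam : ℂ) {f : SuperFn} (hf : oddPart f = 0) (g : SuperFn) :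
    lieDensity lam f * lieDensity lam g =
      lieDensity lam g * lieDensity lam f + lieDensity lam (contactBracket f g) := by
  rw [← lieOp_lieDensity, lieOp_of_even _ _ hf]
  abel

theorem lieDensity_mul_of_odd (lam : ℂ) {f g : SuperFn} (hf : evenPart f = 0)
    (hg : evenPart g = 0) :
    lieDensity lam f * lieDensity lam g =
      -(lieDensity lam g * lieDensity lam f) + lieDensity lam (contactBracket f g) := by
  have h : lieDensity lam (-g) = -lieDensity lam g := by
    simpa using lieDensity_smul lam (-1) g
  rw [← lieOp_lieDensity, lieOp_of_odd _ _ hf, opParity_lieDensity, parity_eq_neg hg, h]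
  noncomm_ring

theorem oddPart_contactBracket_even {f g : SuperFn} (hf : oddPart f = 0) (hg : oddPart g = 0) :
    oddPart (contactBracket f g) = 0 := by
  rw [← evenPart_eq_self hf, ← evenPart_eq_self hg]
  ext1 <;> simp [contactBracket, contactField_f1, contactField_f2]

theorem oddPart_contactBracket_odd {f g : SuperFn} (hf : evenPart f = 0) (hg : evenPart g = 0) :
    oddPart (contactBracket f g) = 0 := by
  rw [← oddPart_eq_self hf, ← oddPart_eq_self hg]
  ext1 <;> simp [contactBracket, contactField_f1, contactField_f2]

theorem evenPart_contactBracket {f g : SuperFn} (hf : oddPart f = 0) (hg : evenPart g = 0) :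
    evenPart (contactBracket f g) = 0 := by
  rw [← evenPart_eq_self hf, ← oddPart_eq_self hg]
  ext1 <;> simp [contactBracket, contactField_f0, contactField_f12]

/-- The Lie derivative of operators, as a linear function of the Hamiltonian. -/
noncomputable def lieAction (lam mu : ℂ) : SuperFn →ₗ[ℂ] Module.End ℂ Op where
  toFun f := lieOp lam mu f
  map_add' f g := by
    ext1 D
    simp only [lieOp, LinearMap.coe_mk, AddHom.coe_mk, LinearMap.add_apply, map_add,
      lieDensity_add]
    noncomm_ring
  map_smul' c f := by
    ext1 D
    simp only [lieOp, LinearMap.coe_mk, AddHom.coe_mk, LinearMap.smul_apply, map_smul,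
      lieDensity_smul, RingHom.id_apply, smul_mul_assoc, mul_smul_comm, smul_sub, smul_add]

theorem lieAction_apply (lam mu : ℂ) (f : SuperFn) : lieAction lam mu f = lieOp lam mu f := rfl

theorem lieAction_even_mul_even (lam mu : ℂ) {f g : SuperFn} (hf : oddPart f = 0)
    (hg : oddPart g = 0) :
    lieAction lam mu f * lieAction lam mu g =
      lieAction lam mu g * lieAction lam mu f + lieAction lam mu (contactBracket f g) := by
  ext1 D
  simp only [Module.End.mul_apply, LinearMap.add_apply, lieAction_apply, lieOp_of_even _ _ hf,
    lieOp_of_even _ _ hg, lieOp_of_even _ _ (oddPart_contactBracket_even hf hg)]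
  linear_combination (norm := noncomm_ring)
    lieDensity_mul_of_even mu hf g * D - D * lieDensity_mul_of_even lam hf g

theorem lieAction_even_mul_odd (lam mu : ℂ) {f g : SuperFn} (hf : oddPart f = 0)
    (hg : evenPart g = 0) :
    lieAction lam mu f * lieAction lam mu g =
      lieAction lam mu g * lieAction lam mu f + lieAction lam mu (contactBracket f g) := by
  ext1 D
  simp only [Module.End.mul_apply, LinearMap.add_apply, lieAction_apply, lieOp_of_even _ _ hf,
    lieOp_of_odd _ _ hg, lieOp_of_odd _ _ (evenPart_contactBracket hf hg), opParity_sub,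
    opParity_mul, opParity_lieDensity, parity_eq_self hf]
  linear_combination (norm := noncomm_ring)
    lieDensity_mul_of_even mu hf g * D - opParity D * lieDensity_mul_of_even lam hf g

theorem lieAction_odd_mul_odd (lam mu : ℂ) {f g : SuperFn} (hf : evenPart f = 0)
    (hg : evenPart g = 0) :
    lieAction lam mu f * lieAction lam mu g =
      -(lieAction lam mu g * lieAction lam mu f) + lieAction lam mu (contactBracket f g) := by
  have h (g : SuperFn) : lieDensity lam (-g) = -lieDensity lam g := by
    simpa using lieDensity_smul lam (-1) g
  have h' (g : SuperFn) : lieDensity mu (-g) = -lieDensity mu g := by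
    simpa using lieDensity_smul mu (-1) g
  ext1 D
  simp only [Module.End.mul_apply, LinearMap.add_apply, LinearMap.neg_apply, lieAction_apply,
    lieOp_of_odd _ _ hf, lieOp_of_odd _ _ hg,
    lieOp_of_even _ _ (oddPart_contactBracket_odd hf hg), opParity_sub,
    opParity_mul, opParity_lieDensity, parity_eq_neg hf, parity_eq_neg hg, h, h',
    opParity_opParity]
  linear_combination (norm := noncomm_ring)
    lieDensity_mul_of_odd mu hf hg * D - D * lieDensity_mul_of_odd lam hf hg

theorem dx_xFn : dx xFn = 1 := by
  ext t
  exact Complex.ofRealCLM.hasDerivAt.deriv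

theorem dx_one : dx 1 = 0 := by
  have h := dx_algebraMap 1
  rwa [map_one] at h

open SuperFn

section components

@[simp] theorem one_f0 : (1 : SuperFn).f0 = 1 := rfl
@[simp] theorem one_f1 : (1 : SuperFn).f1 = 0 := rfl
@[simp] theorem one_f2 : (1 : SuperFn).f2 = 0 := rfl
@[simp] theorem one_f12 : (1 : SuperFn).f12 = 0 := rfl
@[simp] theorem x_f0 : x.f0 = xFn := rfl
@[simp] theorem x_f1 : x.f1 = 0 := rfl
@[simp] theorem x_f2 : x.f2 = 0 := rfl
@[simp] theorem x_f12 : x.f12 = 0 := rfl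
@[simp] theorem θ₁_f0 : θ₁.f0 = 0 := rfl
@[simp] theorem θ₁_f1 : θ₁.f1 = 1 := rfl
@[simp] theorem θ₁_f2 : θ₁.f2 = 0 := rfl
@[simp] theorem θ₁_f12 : θ₁.f12 = 0 := rfl
@[simp] theorem θ₂_f0 : θ₂.f0 = 0 := rfl
@[simp] theorem θ₂_f1 : θ₂.f1 = 0 := rfl
@[simp] theorem θ₂_f2 : θ₂.f2 = 1 := rfl
@[simp] theorem θ₂_f12 : θ₂.f12 = 0 := rfl

end components

theorem two_mul_half : 2 * half = 1 := by rw [two_mul, half_add_half]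

/-- The Casimir operator of `spo(2|2)` attached to operators `ρ f` indexed by Hamiltonians. -/
@[irreducible]
noncomputable def casimir {V : Type*} [AddCommGroup V] [Module ℂ V]
    (ρ : SuperFn → Module.End ℂ V) : Module.End ℂ V :=
  casimirElement (ρ 1) (ρ x) (ρ (x * x)) (ρ (θ₁ * θ₂)) (ρ θ₁) (ρ θ₂) (ρ (x * θ₁)) (ρ (x * θ₂))

/-- The relations of `spo(2|2)` hold for the Lie derivative of operators; they are read off from the
table of contact brackets of the generators. -/
theorem spoRelations_lieAction (lam mu : ℂ) :
    SpoRelations (lieAction lam mu 1) (lieAction lam mu x) (lieAction lam mu (x * x))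
      (lieAction lam mu (θ₁ * θ₂)) (lieAction lam mu θ₁) (lieAction lam mu θ₂)
      (lieAction lam mu (x * θ₁)) (lieAction lam mu (x * θ₂)) := by
  have e0 : oddPart 1 = 0 := by ext1 <;> simp
  have e1 : oddPart x = 0 := by ext1 <;> simp
  have e2 : oddPart (x * x) = 0 := by ext1 <;> simp
  have e3 : oddPart (θ₁ * θ₂) = 0 := by ext1 <;> simp
  have o1 : evenPart θ₁ = 0 := by ext1 <;> simp
  have o2 : evenPart θ₂ = 0 := by ext1 <;> simp
  have o3 : evenPart (x * θ₁) = 0 := by ext1 <;> simp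
  have o4 : evenPart (x * θ₂) = 0 := by ext1 <;> simp
  have hc := two_mul_half
  have ev {f g k : SuperFn} {c : ℂ} (hf : oddPart f = 0) (hg : oddPart g = 0)
      (hk : contactBracket f g = c • k) : lieAction lam mu f * lieAction lam mu g =
        lieAction lam mu g * lieAction lam mu f + c • lieAction lam mu k := by
    rw [lieAction_even_mul_even lam mu hf hg, hk, map_smul]
  have eo {f g k : SuperFn} {c : ℂ} (hf : oddPart f = 0) (hg : evenPart g = 0)
      (hk : contactBracket f g = c • k) : lieAction lam mu f * lieAction lam mu g =
        lieAction lam mu g * lieAction lam mu f + c • lieAction lam mu k := by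
    rw [lieAction_even_mul_odd lam mu hf hg, hk, map_smul]
  have oo {f g k : SuperFn} {c : ℂ} (hf : evenPart f = 0) (hg : evenPart g = 0)
      (hk : contactBracket f g = c • k) : lieAction lam mu f * lieAction lam mu g =
        -(lieAction lam mu g * lieAction lam mu f) + c • lieAction lam mu k := by
    rw [lieAction_odd_mul_odd lam mu hf hg, hk, map_smul]
  have table :
      contactBracket 1 x = (1 : ℂ) • 1 ∧
      contactBracket 1 (x * x) = (2 : ℂ) • x ∧
      contactBracket x (x * x) = (1 : ℂ) • (x * x) ∧
      contactBracket 1 (θ₁ * θ₂) = (0 : ℂ) • 1 ∧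
      contactBracket x (θ₁ * θ₂) = (0 : ℂ) • 1 ∧
      contactBracket (x * x) (θ₁ * θ₂) = (0 : ℂ) • 1 ∧
      contactBracket 1 θ₁ = (0 : ℂ) • 1 ∧
      contactBracket 1 θ₂ = (0 : ℂ) • 1 ∧
      contactBracket 1 (x * θ₁) = (1 : ℂ) • θ₁ ∧
      contactBracket 1 (x * θ₂) = (1 : ℂ) • θ₂ ∧
      contactBracket x θ₁ = (-(1 / 2) : ℂ) • θ₁ ∧
      contactBracket x θ₂ = (-(1 / 2) : ℂ) • θ₂ ∧
      contactBracket x (x * θ₁) = (1 / 2 : ℂ) • (x * θ₁) ∧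
      contactBracket x (x * θ₂) = (1 / 2 : ℂ) • (x * θ₂) ∧
      contactBracket (x * x) θ₁ = (-1 : ℂ) • (x * θ₁) ∧
      contactBracket (x * x) θ₂ = (-1 : ℂ) • (x * θ₂) ∧
      contactBracket (x * x) (x * θ₁) = (0 : ℂ) • 1 ∧
      contactBracket (x * x) (x * θ₂) = (0 : ℂ) • 1 ∧
      contactBracket (θ₁ * θ₂) θ₁ = (-(1 / 2) : ℂ) • θ₂ ∧
      contactBracket (θ₁ * θ₂) θ₂ = (1 / 2 : ℂ) • θ₁ ∧
      contactBracket (θ₁ * θ₂) (x * θ₁) = (-(1 / 2) : ℂ) • (x * θ₂) ∧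
      contactBracket (θ₁ * θ₂) (x * θ₂) = (1 / 2 : ℂ) • (x * θ₁) ∧
      contactBracket θ₁ θ₁ = (1 / 2 : ℂ) • 1 ∧
      contactBracket θ₂ θ₂ = (1 / 2 : ℂ) • 1 ∧
      contactBracket θ₁ θ₂ = (0 : ℂ) • 1 ∧
      contactBracket θ₁ (x * θ₁) = (1 / 2 : ℂ) • x ∧
      contactBracket θ₂ (x * θ₂) = (1 / 2 : ℂ) • x ∧
      contactBracket θ₁ (x * θ₂) = (1 / 2 : ℂ) • (θ₁ * θ₂) ∧
      contactBracket θ₂ (x * θ₁) = (-(1 / 2) : ℂ) • (θ₁ * θ₂) ∧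
      contactBracket (x * θ₁) (x * θ₁) = (1 / 2 : ℂ) • (x * x) ∧
      contactBracket (x * θ₂) (x * θ₂) = (1 / 2 : ℂ) • (x * x) ∧
      contactBracket (x * θ₁) (x * θ₂) = (0 : ℂ) • 1 := by
    refine ⟨?_, ?_, ?_, ?_, ?_, ?_, ?_, ?_, ?_, ?_, ?_, ?_, ?_, ?_, ?_, ?_, ?_, ?_, ?_, ?_,
      ?_, ?_, ?_, ?_, ?_, ?_, ?_, ?_, ?_, ?_, ?_, ?_⟩ <;> ext1 <;>
      simp [contactBracket, contactField_f0, contactField_f1, contactField_f2, contactField_f12,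
        dx_mul, dx_xFn, dx_one, -one_div, half_smul, two_smul] <;> grind
  obtain ⟨q_he, q_fe, q_fh, q_re, q_rh, q_rf, q_a₁e, q_a₂e, q_b₁e, q_b₂e, q_ha₁, q_ha₂, q_hb₁,
    q_hb₂, q_fa₁, q_fa₂, q_fb₁, q_fb₂, q_ra₁, q_ra₂, q_rb₁, q_rb₂, q_a₁a₁, q_a₂a₂, q_a₂a₁,
    q_b₁a₁, q_b₂a₂, q_b₂a₁, q_b₁a₂, q_b₁b₁, q_b₂b₂, q_b₂b₁⟩ := table
  exact {
    he := by linear_combination (norm := module) -ev e0 e1 q_he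
    fe := by linear_combination (norm := module) -ev e0 e2 q_fe
    fh := by linear_combination (norm := module) -ev e1 e2 q_fh
    re := by linear_combination (norm := module) -ev e0 e3 q_re
    rh := by linear_combination (norm := module) -ev e1 e3 q_rh
    rf := by linear_combination (norm := module) ev e2 e3 q_rf
    a₁e := by linear_combination (norm := module) -eo e0 o1 q_a₁e
    a₂e := by linear_combination (norm := module) -eo e0 o2 q_a₂e
    b₁e := by linear_combination (norm := module) -eo e0 o3 q_b₁e
    b₂e := by linear_combination (norm := module) -eo e0 o4 q_b₂e
    ha₁ := by linear_combination (norm := module) eo e1 o1 q_ha₁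
    ha₂ := by linear_combination (norm := module) eo e1 o2 q_ha₂
    hb₁ := by linear_combination (norm := module) -eo e1 o3 q_hb₁
    hb₂ := by linear_combination (norm := module) -eo e1 o4 q_hb₂
    fa₁ := by linear_combination (norm := module) eo e2 o1 q_fa₁
    fa₂ := by linear_combination (norm := module) eo e2 o2 q_fa₂
    fb₁ := by linear_combination (norm := module) eo e2 o3 q_fb₁
    fb₂ := by linear_combination (norm := module) eo e2 o4 q_fb₂
    ra₁ := by linear_combination (norm := module) eo e3 o1 q_ra₁
    ra₂ := by linear_combination (norm := module) eo e3 o2 q_ra₂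
    rb₁ := by linear_combination (norm := module) -eo e3 o3 q_rb₁
    rb₂ := by linear_combination (norm := module) -eo e3 o4 q_rb₂
    a₁a₁ := by linear_combination (norm := module) (1 / 2 : ℂ) • oo o1 o1 q_a₁a₁
    a₂a₂ := by linear_combination (norm := module) (1 / 2 : ℂ) • oo o2 o2 q_a₂a₂
    a₂a₁ := by linear_combination (norm := module) oo o1 o2 q_a₂a₁
    b₁a₁ := by linear_combination (norm := module) oo o1 o3 q_b₁a₁
    b₂a₂ := by linear_combination (norm := module) oo o2 o4 q_b₂a₂
    b₂a₁ := by linear_combination (norm := module) oo o1 o4 q_b₂a₁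
    b₁a₂ := by linear_combination (norm := module) oo o2 o3 q_b₁a₂
    b₁b₁ := by linear_combination (norm := module) (1 / 2 : ℂ) • oo o3 o3 q_b₁b₁
    b₂b₂ := by linear_combination (norm := module) (1 / 2 : ℂ) • oo o4 o4 q_b₂b₂
    b₂b₁ := by linear_combination (norm := module) oo o3 o4 q_b₂b₁ }

/-- Maps that commute with the action of `spo(2|2)` commute with the Casimir operators. -/
theorem casimir_intertwine {V W : Type*} [AddCommGroup V] [Module ℂ V] [AddCommGroup W]
    [Module ℂ W] {ρ : SuperFn → Module.End ℂ V} {σ : SuperFn → Module.End ℂ W} (φ : V →ₗ[ℂ] W)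
    (h : ∀ f ∈ spoHamiltonians, ∀ v, φ (ρ f v) = σ f (φ v)) (v : V) :
    φ (casimir ρ v) = casimir σ (φ v) := by
  have hs {g : SuperFn} (hg : g ∈ ({1, x, θ₁, θ₂, θ₁ * θ₂, x * x, x * θ₁, x * θ₂} : Set SuperFn))
      (v : V) : φ (ρ g v) = σ g (φ v) := h g (Submodule.subset_span hg) v
  simp only [casimir, casimirElement, LinearMap.add_apply, LinearMap.sub_apply,
    LinearMap.smul_apply, Module.End.mul_apply, map_add, map_sub, map_smul]
  rw [hs, hs, hs, hs, hs, hs, hs, hs, hs, hs] <;> simp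

/-! ### The Casimir operator on weighted functions -/

theorem commute_casimir_lieOp (lam mu : ℂ) {f : SuperFn} (hf : f ∈ spoHamiltonians) :
    Commute (casimir (lieOp lam mu)) (lieOp lam mu f) := by
  have H := spoRelations_lieAction lam mu
  obtain ⟨o1, o2, o3, o4⟩ := H.commute_casimirElement_odd
  obtain ⟨e1, e2, e3, e4⟩ := H.commute_casimirElement_even
  change Commute (casimir (lieAction lam mu)) (lieAction lam mu f)
  rw [casimir]
  unfold spoHamiltonians at hf
  induction hf using Submodule.span_induction with
  | mem f hf =>
    rcases hf with rfl | rfl | rfl | rfl | rfl | rfl | rfl | rfl 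
    exacts [e1, e2, o1, o2, e4, e3, o3, o4]
  | zero => rw [map_zero]; exact Commute.zero_right _
  | add f g _ _ hf hg => rw [map_add]; exact hf.add_right hg
  | smul c f _ hf => rw [map_smul]; exact hf.smul_right c

/-- The action `a ↦ X_f(a) + w f' a + q D̄₁D̄₂(f) a` on sections of weight `w` and of charge `q`
with respect to the rotations of `(D̄₁, D̄₂)`. -/
noncomputable def weightAction (w q : ℂ) (f : SuperFn) : Op :=
  contactField f + w • mulL (pdx f) + q • mulL (D₁ (D₂ f))

/-- The Casimir operator acts on functions of weight `w` and charge `q` by the scalar `w² + q²`. -/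
theorem casimir_weightAction (w q : ℂ) (a : SuperFn) :
    casimir (weightAction w q) a = (w ^ 2 + q ^ 2) • a := by
  have hc := two_mul_half
  have h2 : algebraMap ℂ SmoothFn 2 = 2 := map_ofNat _ 2
  simp only [casimir, casimirElement, weightAction]
  ext1 <;> simp [contactField_f0, contactField_f1, contactField_f2, contactField_f12, dx_mul,
    dx_half, dx_two, dx_xFn, dx_one, Algebra.smul_def, h2] <;> grind

/-! ### Weight vectors: operators with a scalar symbol action -/

/-- The differential operators of order strictly less than `n / 2`. -/
noncomputable def lowerOp : ℕ → Submodule ℂ Op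
  | 0 => ⊥
  | n + 1 => diffOpOrder n

theorem lowerOp_le (n : ℕ) : lowerOp n ≤ diffOpOrder n := by
  cases n with
  | zero => exact bot_le
  | succ n => exact diffOpOrder_mono n.le_succ

theorem diffOpOrder_le_lowerOp {m n : ℕ} (h : m < n) : diffOpOrder m ≤ lowerOp n := by
  cases n with
  | zero => omega
  | succ n => exact diffOpOrder_mono (Nat.lt_succ_iff.1 h)

theorem lowerOp_mul_mem {n m : ℕ} {S T : Op} (hS : S ∈ lowerOp n) (hT : T ∈ diffOpOrder m) :
    S * T ∈ lowerOp (n + m) := by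
  cases n with
  | zero =>
    rw [lowerOp, Submodule.mem_bot] at hS
    rw [hS, zero_mul]
    exact zero_mem _
  | succ n =>
    rw [Nat.add_right_comm]
    exact mul_mem_order hS hT

theorem mul_lowerOp_mem {n m : ℕ} {S T : Op} (hS : S ∈ diffOpOrder n) (hT : T ∈ lowerOp m) :
    S * T ∈ lowerOp (n + m) := by
  cases m with
  | zero =>
    rw [lowerOp, Submodule.mem_bot] at hT
    rw [hT, mul_zero]
    exact zero_mem _
  | succ m => exact mul_mem_order hS hT

theorem mulL_mul_lowerOp_mem (a : SuperFn) {n : ℕ} {T : Op} (hT : T ∈ lowerOp n) :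
    mulL a * T ∈ lowerOp n := by
  simpa using mul_lowerOp_mem (mulL_mem a 0) hT

theorem lieOp_mem_lowerOp (lam mu : ℂ) (f : SuperFn) {n : ℕ} {D : Op} (hD : D ∈ lowerOp n) :
    lieOp lam mu f D ∈ lowerOp n := by
  cases n with
  | zero =>
    rw [lowerOp, Submodule.mem_bot] at hD
    rw [hD, map_zero]
    exact zero_mem _
  | succ n => exact lieOp_mem lam mu f hD

/-- The function `-(n/2) f' + q D̄₁D̄₂(f)` by which the bracket with `X_f` multiplies the symbol of
an operator of order `n / 2` and charge `q`. -/
noncomputable def symbolFactor (n : ℕ) (q : ℂ) : SuperFn →ₗ[ℂ] SuperFn :=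
  (-((n : ℂ) / 2)) • pdx + q • (D₁ * D₂)

theorem symbolFactor_add (m n : ℕ) (p q : ℂ) (f : SuperFn) :
    symbolFactor (m + n) (p + q) f = symbolFactor m p f + symbolFactor n q f := by
  simp only [symbolFactor, LinearMap.add_apply, LinearMap.smul_apply, Nat.cast_add]
  module

theorem oddPart_symbolFactor_evenPart (n : ℕ) (q : ℂ) (f : SuperFn) :
    oddPart (symbolFactor n q (evenPart f)) = 0 := by
  ext1 <;> simp [symbolFactor]

theorem evenPart_symbolFactor_oddPart (n : ℕ) (q : ℂ) (f : SuperFn) :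
    evenPart (symbolFactor n q (oddPart f)) = 0 := by
  ext1 <;> simp [symbolFactor]

/-- Operators of order `n / 2` whose symbol supercommutes with functions and is multiplied by
`-(n/2) f' + q D̄₁D̄₂(f)` by the bracket with `X_f`. -/
structure IsWeightVector (n : ℕ) (q : ℂ) (T : Op) : Prop where
  mem : T ∈ diffOpOrder n
  comm_even : ∀ g, oddPart g = 0 → T * mulL g - mulL g * T ∈ lowerOp n
  comm_odd : ∀ g, evenPart g = 0 → opParity T * mulL g - mulL g * T ∈ lowerOp n
  bracket : ∀ f, fieldBracket f T - mulL (symbolFactor n q f) * T ∈ lowerOp n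

theorem fieldBracket_add (f : SuperFn) (D E : Op) :
    fieldBracket f (D + E) = fieldBracket f D + fieldBracket f E := by
  simp only [fieldBracket, opParity]
  noncomm_ring

theorem fieldBracket_smul (f : SuperFn) (c : ℂ) (D : Op) :
    fieldBracket f (c • D) = c • fieldBracket f D := by
  simp only [fieldBracket, opParity, mul_smul_comm, smul_mul_assoc, smul_sub, smul_add]

theorem opParity_smul (c : ℂ) (D : Op) : opParity (c • D) = c • opParity D := by
  simp only [opParity, mul_smul_comm, smul_mul_assoc]

theorem opParity_mulL (a : SuperFn) : opParity (mulL a) = mulL (parity a) := by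
  ext1 g
  ext1 <;> simp [opParity] <;> ring

theorem opParity_one : opParity 1 = 1 := by
  ext1 g
  ext1 <;> simp [opParity]

theorem opParity_pdx : opParity pdx = pdx := by
  ext1 g
  ext1 <;> simp [opParity]

theorem opParity_D₁ : opParity D₁ = -D₁ := by
  ext1 g
  ext1 <;> simp [opParity]

theorem opParity_D₂ : opParity D₂ = -D₂ := by
  ext1 g
  ext1 <;> simp [opParity]

namespace IsWeightVector

theorem add {n : ℕ} {q : ℂ} {S T : Op} (hS : IsWeightVector n q S) (hT : IsWeightVector n q T) :
    IsWeightVector n q (S + T) where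
  mem := add_mem hS.mem hT.mem
  comm_even g hg := by
    convert add_mem (hS.comm_even g hg) (hT.comm_even g hg) using 1
    noncomm_ring
  comm_odd g hg := by
    convert add_mem (hS.comm_odd g hg) (hT.comm_odd g hg) using 1
    rw [opParity_add]
    noncomm_ring
  bracket f := by
    convert add_mem (hS.bracket f) (hT.bracket f) using 1
    rw [fieldBracket_add]
    noncomm_ring

theorem smul {n : ℕ} {q : ℂ} {T : Op} (hT : IsWeightVector n q T) (c : ℂ) :
    IsWeightVector n q (c • T) where
  mem := Submodule.smul_mem _ c hT.mem
  comm_even g hg := by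
    convert Submodule.smul_mem _ c (hT.comm_even g hg) using 1
    rw [smul_mul_assoc, mul_smul_comm, smul_sub]
  comm_odd g hg := by
    convert Submodule.smul_mem _ c (hT.comm_odd g hg) using 1
    rw [opParity_smul, smul_mul_assoc, mul_smul_comm, smul_sub]
  bracket f := by
    convert Submodule.smul_mem _ c (hT.bracket f) using 1
    rw [fieldBracket_smul, mul_smul_comm, smul_sub]

theorem mul {m n : ℕ} {p q : ℂ} {S T : Op} (hS : IsWeightVector m p S)
    (hT : IsWeightVector n q T) : IsWeightVector (m + n) (p + q) (S * T) where
  mem := mul_mem_order hS.mem hT.mem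
  comm_even g hg := by
    convert add_mem (mul_lowerOp_mem hS.mem (hT.comm_even g hg))
      (lowerOp_mul_mem (hS.comm_even g hg) hT.mem) using 1
    noncomm_ring
  comm_odd g hg := by
    convert add_mem (mul_lowerOp_mem (opParity_mem hS.mem) (hT.comm_odd g hg))
      (lowerOp_mul_mem (hS.comm_odd g hg) hT.mem) using 1
    rw [opParity_mul]
    noncomm_ring
  bracket f := by
    have hf : mulL (symbolFactor n q f) =
        mulL (symbolFactor n q (evenPart f)) + mulL (symbolFactor n q (oddPart f)) := by
      rw [← map_add, ← map_add, even_add_odd]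
    convert add_mem (add_mem (lowerOp_mul_mem (hS.bracket f) hT.mem)
      (add_mem (mul_lowerOp_mem hS.mem (hT.bracket (evenPart f)))
        (mul_lowerOp_mem (opParity_mem hS.mem) (hT.bracket (oddPart f)))))
      (add_mem
        (lowerOp_mul_mem (hS.comm_even _ (oddPart_symbolFactor_evenPart n q f)) hT.mem)
        (lowerOp_mul_mem (hS.comm_odd _ (evenPart_symbolFactor_oddPart n q f)) hT.mem)) using 1
    rw [fieldBracket_mul, symbolFactor_add, map_add, hf]
    noncomm_ring

theorem one : IsWeightVector 0 0 1 where
  mem := one_mem 0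
  comm_even g _ := by simp
  comm_odd g _ := by simp [opParity_one]
  bracket f := by
    have h : contactField f 1 = 0 := by
      ext1 <;> simp [contactField_f0, contactField_f1, contactField_f2, contactField_f12, dx_one]
    rw [← mulL_one, fieldBracket_mulL, h]
    simp [symbolFactor]

theorem pow {n : ℕ} {q : ℂ} {T : Op} (hT : IsWeightVector n q T) (k : ℕ) :
    IsWeightVector (n * k) (q * k) (T ^ k) := by
  induction k with
  | zero => simpa using one
  | succ k ih =>
    have h := ih.mul hT
    rwa [← pow_succ, ← Nat.mul_succ, show q * k + q = q * (k + 1 : ℕ) by push_cast; ring] at h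

end IsWeightVector

theorem isWeightVector_pdx : IsWeightVector 2 0 pdx where
  mem := pdx_mem
  comm_even g _ := by
    rw [pdx_mulL, add_sub_cancel_right]
    exact mulL_mem _ 1
  comm_odd g _ := by
    rw [opParity_pdx, pdx_mulL, add_sub_cancel_right]
    exact mulL_mem _ 1
  bracket f := by
    have h : fieldBracket f pdx - mulL (symbolFactor 2 0 f) * pdx =
        (1 / 2 : ℂ) • (mulL (D₁ (parity (pdx f))) * D₁ + mulL (D₂ (parity (pdx f))) * D₂) := by
      rw [fieldBracket_pdx, contactField]
      simp [symbolFactor]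
    rw [h]
    exact Submodule.smul_mem _ _ (add_mem (mulL_mul_mem _ D₁_mem) (mulL_mul_mem _ D₂_mem))

/-- The isotropic combinations of `D̄₁` and `D̄₂` diagonalize the rotations. -/
theorem isWeightVector_isotropic {c : ℂ} (hc : c ^ 2 = -1) :
    IsWeightVector 1 (-(c / 2)) (D₁ + c • D₂) where
  mem := add_mem D₁_mem (Submodule.smul_mem _ _ D₂_mem)
  comm_even g hg := by
    have h : (D₁ + c • D₂) * mulL g - mulL g * (D₁ + c • D₂) = mulL (D₁ g) + c • mulL (D₂ g) := by
      simp only [add_mul, mul_add, smul_mul_assoc, mul_smul_comm, D₁_mulL, D₂_mulL,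
        parity_eq_self hg]
      module
    rw [h]
    exact add_mem (mulL_mem _ 0) (Submodule.smul_mem _ _ (mulL_mem _ 0))
  comm_odd g hg := by
    have h : opParity (D₁ + c • D₂) * mulL g - mulL g * (D₁ + c • D₂) =
        -(mulL (D₁ g) + c • mulL (D₂ g)) := by
      simp only [opParity_add, opParity_smul, opParity_D₁, opParity_D₂, add_mul, mul_add,
        smul_mul_assoc, mul_smul_comm, neg_mul, D₁_mulL, D₂_mulL, parity_eq_neg hg, map_neg]
      module
    rw [h]
    exact neg_mem (add_mem (mulL_mem _ 0) (Submodule.smul_mem _ _ (mulL_mem _ 0)))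
  bracket f := by
    have h : fieldBracket f (D₁ + c • D₂) - mulL (symbolFactor 1 (-(c / 2)) f) * (D₁ + c • D₂) =
        ((c ^ 2 + 1) / 2) • (mulL (D₁ (D₂ f)) * D₂) := by
      simp only [fieldBracket_add, fieldBracket_smul, fieldBracket_D₁, fieldBracket_D₂,
        symbolFactor, LinearMap.add_apply, LinearMap.smul_apply, Module.End.mul_apply, map_add,
        map_smul, add_mul, mul_add, smul_mul_assoc, mul_smul_comm, Nat.cast_one]
      module
    rw [h, hc, neg_add_cancel, zero_div, zero_smul]
    exact zero_mem _

theorem mulL_mul_mulL_split (a h : SuperFn) :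
    mulL a * mulL (evenPart h) + mulL (parity a) * mulL (oddPart h) = mulL (h * a) := by
  ext1 g
  ext1 <;> simp <;> ring

/-- On the symbols `a T`, with `T` a weight vector, the Lie derivative is an action of weight
`mu - lam - n / 2` on the coefficient `a`. -/
theorem lieOp_mulL_mul {n : ℕ} {q : ℂ} {T : Op} (hT : IsWeightVector n q T) (lam mu : ℂ)
    (f a : SuperFn) :
    lieOp lam mu f (mulL a * T) - mulL (weightAction (mu - lam - n / 2) q f a) * T ∈ lowerOp n := by
  have e : lieOp lam mu f (mulL a * T) = fieldBracket f (mulL a * T) +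
      mu • (mulL (pdx f) * (mulL a * T)) - lam • (mulL a * T * mulL (pdx (evenPart f)) +
        opParity (mulL a * T) * mulL (pdx (oddPart f))) := by
    simp only [lieOp, LinearMap.coe_mk, AddHom.coe_mk, lieDensity, fieldBracket, mul_add, add_mul,
      smul_mul_assoc, mul_smul_comm, smul_add]
    abel
  have he : oddPart (pdx (evenPart f)) = 0 := by ext1 <;> simp
  have ho : evenPart (pdx (oddPart f)) = 0 := by ext1 <;> simp
  have s1 := mulL_mul_mulL_split a (pdx f)
  have s2 := mulL_mul_mulL_split a (symbolFactor n q f)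
  rw [show evenPart (pdx f) = pdx (evenPart f) by ext1 <;> simp,
    show oddPart (pdx f) = pdx (oddPart f) by ext1 <;> simp] at s1
  rw [show evenPart (symbolFactor n q f) = symbolFactor n q (evenPart f) by
      ext1 <;> simp [symbolFactor],
    show oddPart (symbolFactor n q f) = symbolFactor n q (oddPart f) by
      ext1 <;> simp [symbolFactor]] at s2
  have hW : mulL (weightAction (mu - lam - n / 2) q f a) = mulL (contactField f a) +
      mulL (symbolFactor n q f * a) + (mu - lam) • mulL (pdx f * a) := by
    rw [← map_smul, ← map_add, ← map_add]
    congr 1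
    simp only [weightAction, symbolFactor, LinearMap.add_apply, LinearMap.smul_apply, mulL_apply,
      Module.End.mul_apply, ← mulL_apply (_ + _), map_add, map_smul]
    module
  convert sub_mem (add_mem (mulL_mul_lowerOp_mem a (hT.bracket (evenPart f)))
      (mulL_mul_lowerOp_mem (parity a) (hT.bracket (oddPart f))))
    (Submodule.smul_mem _ lam (add_mem (mulL_mul_lowerOp_mem a (hT.comm_even _ he))
      (mulL_mul_lowerOp_mem (parity a) (hT.comm_odd _ ho)))) using 1
  rw [e, fieldBracket_mul, fieldBracket_mulL, hW, ← s1, ← s2, opParity_mul, opParity_mulL]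
  rw [← mul_assoc, mulL_mul, ← s1]
  simp only [add_mul, mul_sub, sub_mul, smul_add, smul_sub, sub_smul, mul_assoc,
    smul_mul_assoc]
  abel

/-! ### The Casimir operator on symbols -/

theorem casimir_mulL_mul {n : ℕ} {q : ℂ} {T : Op} (hT : IsWeightVector n q T) (lam mu : ℂ)
    (a : SuperFn) :
    casimir (lieOp lam mu) (mulL a * T) -
      ((mu - lam - n / 2) ^ 2 + q ^ 2) • (mulL a * T) ∈ lowerOp n := by
  -- Modulo lower order, `a ↦ a T` intertwines `weightAction` and the Lie derivative.
  let σ (f : SuperFn) : Module.End ℂ (Op ⧸ lowerOp n) :=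
    (lowerOp n).mapQ (lowerOp n) (lieOp lam mu f) fun _ hD => lieOp_mem_lowerOp lam mu f hD
  let φ : SuperFn →ₗ[ℂ] Op ⧸ lowerOp n :=
    (lowerOp n).mkQ ∘ₗ LinearMap.mulRight ℂ T ∘ₗ mulL
  have h1 := casimir_intertwine (ρ := lieOp lam mu) (σ := σ) (lowerOp n).mkQ
    (fun f _ D => rfl) (mulL a * T)
  have h2 := casimir_intertwine (ρ := weightAction (mu - lam - n / 2) q) (σ := σ) φ
    (fun f _ b => ((Submodule.Quotient.eq _).2 (lieOp_mulL_mul hT lam mu f b)).symm) a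
  rw [casimir_weightAction, map_smul] at h2
  exact (Submodule.Quotient.eq _).1 (h1.trans h2.symm)

theorem D₁_mul_D₁ : D₁ * D₁ = -pdx := by
  ext1 g
  ext1 <;> simp

theorem D₂_mul_D₂ : D₂ * D₂ = -pdx := by
  ext1 g
  ext1 <;> simp

theorem isWeightVector_D₁_mul_D₂ : IsWeightVector 2 0 (D₁ * D₂) := by
  have h := (isWeightVector_isotropic Complex.I_sq).mul
    (isWeightVector_isotropic (c := -Complex.I) (by simp))
  rw [show -(Complex.I / 2) + -(-Complex.I / 2) = 0 by ring] at h
  have e : D₁ * D₂ =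
      (Complex.I / 2) • ((D₁ + Complex.I • D₂) * (D₁ + -Complex.I • D₂) + (2 : ℂ) • pdx) := by
    simp only [add_mul, mul_add, smul_mul_assoc, mul_smul_comm, D₁_mul_D₁, D₂_mul_D₂, D₂_D₁,
      smul_add, smul_smul, smul_neg]
    have hI := Complex.I_mul_I
    match_scalars <;> grind
  rw [e]
  exact (h.add (isWeightVector_pdx.smul 2)).smul _

/-- The subspace of the operators that the Casimir operator multiplies by `α_{n/2}`, modulo
operators of order less than `n / 2`. -/
noncomputable def casimirSpace (lam mu : ℂ) (n : ℕ) : Submodule ℂ Op where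
  carrier := {D | casimir (lieOp lam mu) D - casimirValue (mu - lam) n • D ∈ lowerOp n}
  zero_mem' := by simp
  add_mem' {D E} hD hE := by
    rw [Set.mem_ofPred_eq] at hD hE ⊢
    rw [map_add, smul_add, add_sub_add_comm]
    exact add_mem hD hE
  smul_mem' c D hD := by
    rw [Set.mem_ofPred_eq] at hD ⊢
    rw [map_smul, smul_comm _ c, ← smul_sub]
    exact Submodule.smul_mem _ c hD

theorem mem_casimirSpace {lam mu : ℂ} {n : ℕ} {D : Op} : D ∈ casimirSpace lam mu n ↔
    casimir (lieOp lam mu) D - casimirValue (mu - lam) n • D ∈ lowerOp n := Iff.rfl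

theorem casimir_mem (lam mu : ℂ) {P : Submodule ℂ Op}
    (hP : ∀ f, ∀ D ∈ P, lieOp lam mu f D ∈ P) {D : Op} (hD : D ∈ P) :
    casimir (lieOp lam mu) D ∈ P := by
  simp only [casimir, casimirElement, LinearMap.add_apply, LinearMap.sub_apply,
    LinearMap.smul_apply, Module.End.mul_apply]
  exact add_mem (sub_mem (add_mem (hP _ _ (hP _ _ hD)) (hP _ _ (hP _ _ hD)))
    (hP _ _ (hP _ _ hD)))
    (Submodule.smul_mem _ _ (add_mem (hP _ _ (hP _ _ hD)) (hP _ _ (hP _ _ hD))))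

theorem mulL_pdx_mem_casimirSpace (lam mu : ℂ) (a : SuperFn) (l : ℕ) :
    mulL a * pdx ^ l ∈ casimirSpace lam mu (2 * l) := by
  have h := casimir_mulL_mul (isWeightVector_pdx.pow l) lam mu a
  rw [mem_casimirSpace, casimirValue, if_pos (even_two_mul l)]
  simpa using h

theorem mulL_pdx_D₁_D₂_mem_casimirSpace (lam mu : ℂ) (a : SuperFn) (l : ℕ) :
    mulL a * pdx ^ l * D₁ * D₂ ∈ casimirSpace lam mu (2 * l + 2) := by
  have h := casimir_mulL_mul ((isWeightVector_pdx.pow l).mul isWeightVector_D₁_mul_D₂) lam mu a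
  rw [mem_casimirSpace, casimirValue, if_pos (by simp [parity_simps])]
  simpa [mul_assoc] using h

theorem mulL_pdx_isotropic_mem_casimirSpace (lam mu : ℂ) (a : SuperFn) (l : ℕ) {c : ℂ}
    (hc : c ^ 2 = -1) : mulL a * pdx ^ l * (D₁ + c • D₂) ∈ casimirSpace lam mu (2 * l + 1) := by
  have h := casimir_mulL_mul ((isWeightVector_pdx.pow l).mul (isWeightVector_isotropic hc)) lam mu a
  rw [mem_casimirSpace, casimirValue, if_neg (by simp [parity_simps])]
  have hq : (0 * (l : ℂ) + -(c / 2)) ^ 2 = -(1 / 4) := by linear_combination hc / 4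
  rw [hq, ← sub_eq_add_neg] at h
  simpa only [mul_assoc] using h

theorem mulL_pdx_D₁_mem_casimirSpace (lam mu : ℂ) (a : SuperFn) (l : ℕ) :
    mulL a * pdx ^ l * D₁ ∈ casimirSpace lam mu (2 * l + 1) := by
  have h1 := mulL_pdx_isotropic_mem_casimirSpace lam mu a l Complex.I_sq
  have h2 := mulL_pdx_isotropic_mem_casimirSpace lam mu a l (c := -Complex.I) (by simp)
  convert Submodule.smul_mem _ (1 / 2 : ℂ) (add_mem h1 h2) using 1
  simp only [mul_add, mul_smul_comm]
  module

theorem mulL_pdx_D₂_mem_casimirSpace (lam mu : ℂ) (a : SuperFn) (l : ℕ) :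
    mulL a * pdx ^ l * D₂ ∈ casimirSpace lam mu (2 * l + 1) := by
  have h1 := mulL_pdx_isotropic_mem_casimirSpace lam mu a l Complex.I_sq
  have h2 := mulL_pdx_isotropic_mem_casimirSpace lam mu a l (c := -Complex.I) (by simp)
  convert Submodule.smul_mem _ (-Complex.I / 2) (sub_mem h1 h2) using 1
  simp only [mul_add, mul_smul_comm]
  have hI := Complex.I_mul_I
  match_scalars <;> grind

/-- Since `D̄₁² = D̄₂² = -∂_x`, only exponents `0` and `1` of `D̄₁` and `D̄₂` matter. -/
theorem monomial_mem_casimirSpace (lam mu : ℂ) (a : SuperFn) (l m p : ℕ) :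
    mulL a * pdx ^ l * D₁ ^ m * D₂ ^ p ∈ casimirSpace lam mu (2 * l + m + p) := by
  match m, p with
  | m + 2, p =>
    have h := monomial_mem_casimirSpace lam mu a (l + 1) m p
    rw [show 2 * (l + 1) + m + p = 2 * l + (m + 2) + p by ring] at h
    convert neg_mem h using 1
    rw [show m + 2 = 2 + m by omega, pow_add D₁ 2, pow_two, D₁_mul_D₁, pow_succ pdx]
    noncomm_ring
  | m, p + 2 =>
    have h := monomial_mem_casimirSpace lam mu a (l + 1) m p
    have c1 : Commute (D₁ ^ m) pdx := (show Commute D₁ pdx from D₁_pdx).pow_left m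
    rw [show 2 * (l + 1) + m + p = 2 * l + m + (p + 2) by ring] at h
    convert neg_mem h using 1
    rw [show p + 2 = 2 + p by omega, pow_add D₂ 2, pow_two, D₂_mul_D₂, pow_succ pdx,
        ← mul_assoc (mulL a), mul_assoc _ pdx, ← c1.eq]
    noncomm_ring
  | 0, 0 => simpa using mulL_pdx_mem_casimirSpace lam mu a l
  | 1, 0 => simpa using mulL_pdx_D₁_mem_casimirSpace lam mu a l
  | 0, 1 => simpa using mulL_pdx_D₂_mem_casimirSpace lam mu a l
  | 1, 1 => simpa using mulL_pdx_D₁_D₂_mem_casimirSpace lam mu a l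
termination_by m + p

/-- The Casimir operator acts on symbols of degree `n / 2` by the scalar `α_{n/2}`. -/
theorem casimir_sub_smul_mem (lam mu : ℂ) {n : ℕ} {D : Op} (hD : D ∈ diffOpOrder n) :
    casimir (lieOp lam mu) D - casimirValue (mu - lam) n • D ∈ lowerOp n := by
  have h : diffOpOrder n ≤ casimirSpace lam mu n := by
    refine Submodule.span_le.2 ?_
    rintro T ⟨a, l, m, p, hle, rfl⟩
    rcases hle.eq_or_lt with rfl | hlt
    · exact monomial_mem_casimirSpace lam mu a l m p
    · have hT := diffOpOrder_le_lowerOp hlt (monomial_mem a (l := l) (m := m) (p := p) le_rfl)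
      exact sub_mem (casimir_mem lam mu (fun f D => lieOp_mem_lowerOp lam mu f) hT)
        (Submodule.smul_mem _ _ hT)
  exact h hD

/-! ### Symbols of differential operators -/

theorem mem_lowerOrder {n : ℕ} {D : diffOpOrder n} : D ∈ lowerOrder n ↔ (D : Op) ∈ lowerOp n := by
  cases n with
  | zero => simp [lowerOrder, lowerOp]
  | succ n => rfl

theorem principalSymbol_eq_iff {n : ℕ} {D E : diffOpOrder n} :
    principalSymbol n D = principalSymbol n E ↔ (D : Op) - E ∈ lowerOp n :=
  (Submodule.Quotient.eq _).trans mem_lowerOrder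

theorem principalSymbol_surjective (n : ℕ) : Function.Surjective (principalSymbol n) :=
  Submodule.mkQ_surjective _

theorem lieSymbol_lof_principalSymbol (lam mu : ℂ) (f : SuperFn) (n : ℕ) (D : diffOpOrder n) :
    lieSymbol lam mu f (DirectSum.lof ℂ ℕ Symbol n (principalSymbol n D)) =
      DirectSum.lof ℂ ℕ Symbol n (principalSymbol n (lieOrder lam mu f n D)) := by
  rw [lieSymbol, DirectSum.lmap_lof]
  rfl

theorem casimir_lieSymbol (lam mu : ℂ) (n : ℕ) (S : Symbol n) :
    casimir (lieSymbol lam mu) (DirectSum.lof ℂ ℕ Symbol n S) =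
      casimirValue (mu - lam) n • DirectSum.lof ℂ ℕ Symbol n S := by
  obtain ⟨D, rfl⟩ := principalSymbol_surjective n S
  have h1 := casimir_intertwine (ρ := fun f => lieOrder lam mu f n) (σ := lieOp lam mu)
    (diffOpOrder n).subtype (fun f _ D => rfl) D
  have h2 := casimir_intertwine (ρ := fun f => lieOrder lam mu f n) (σ := lieSymbol lam mu)
    (DirectSum.lof ℂ ℕ Symbol n ∘ₗ principalSymbol n)
    (fun f _ D => (lieSymbol_lof_principalSymbol lam mu f n D).symm) D
  rw [LinearMap.comp_apply, LinearMap.comp_apply] at h2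
  rw [← h2, ← map_smul, ← map_smul]
  congr 1
  rw [principalSymbol_eq_iff]
  have h3 := casimir_sub_smul_mem lam mu D.2
  rwa [← Submodule.subtype_apply, ← h1] at h3

/-! ### Projections onto the eigenspaces of the Casimir operator -/

/-- The product over `i < m` of `(C - α_{i/2}) / (α_{n/2} - α_{i/2})`, where `C` is the Casimir
operator. For `m = n` it projects operators of order `n / 2` onto the eigenspace of `α_{n/2}`. -/
noncomputable def casimirProj (lam mu : ℂ) (n : ℕ) : ℕ → Module.End ℂ Op
  | 0 => 1
  | m + 1 => casimirProj lam mu n m *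
      ((casimirValue (mu - lam) n - casimirValue (mu - lam) m)⁻¹ •
        (casimir (lieOp lam mu) - casimirValue (mu - lam) m • 1))

theorem casimirProj_succ_apply (lam mu : ℂ) (n m : ℕ) (D : Op) :
    casimirProj lam mu n (m + 1) D = casimirProj lam mu n m
      ((casimirValue (mu - lam) n - casimirValue (mu - lam) m)⁻¹ •
        (casimir (lieOp lam mu) D - casimirValue (mu - lam) m • D)) := rfl

/-- Each factor `C - α_{i/2}` lowers the order of an operator of order `i / 2`. -/
theorem casimirProj_of_mem_lowerOp (lam mu : ℂ) (n : ℕ) {m : ℕ} {D : Op} (hD : D ∈ lowerOp m) :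
    casimirProj lam mu n m D = 0 := by
  induction m generalizing D with
  | zero =>
    rw [lowerOp, Submodule.mem_bot] at hD
    rw [hD, map_zero]
  | succ m ih =>
    rw [casimirProj_succ_apply]
    exact ih (Submodule.smul_mem _ _ (casimir_sub_smul_mem lam mu hD))

variable {lam mu : ℂ}

theorem casimirValue_sub_ne_zero (hδ : ¬ IsCritical (mu - lam)) {m n : ℕ} (h : m < n) :
    casimirValue (mu - lam) n - casimirValue (mu - lam) m ≠ 0 :=
  fun h0 => hδ ⟨n, m, h, sub_eq_zero.1 h0⟩

theorem casimirProj_sub_mem (hδ : ¬ IsCritical (mu - lam)) {m n : ℕ} (hm : m ≤ n) {D : Op}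
    (hD : D ∈ diffOpOrder n) : casimirProj lam mu n m D - D ∈ lowerOp n := by
  induction m generalizing D with
  | zero => simp [casimirProj]
  | succ m ih =>
    have hne := casimirValue_sub_ne_zero hδ (Nat.lt_of_succ_le hm)
    rw [casimirProj_succ_apply]
    set E := (casimirValue (mu - lam) n - casimirValue (mu - lam) m)⁻¹ •
      (casimir (lieOp lam mu) D - casimirValue (mu - lam) m • D) with hE
    have h1 : E - D ∈ lowerOp n := by
      have e : E - D = (casimirValue (mu - lam) n - casimirValue (mu - lam) m)⁻¹ •
          (casimir (lieOp lam mu) D - casimirValue (mu - lam) n • D) := by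
        rw [hE]
        match_scalars <;> field_simp
        ring
      rw [e]
      exact Submodule.smul_mem _ _ (casimir_sub_smul_mem lam mu hD)
    have h2 : E ∈ diffOpOrder n := by
      simpa using add_mem (lowerOp_le n h1) hD
    simpa using add_mem (ih (by omega) h2) h1

theorem casimirProj_mem (hδ : ¬ IsCritical (mu - lam)) {n : ℕ} {D : Op}
    (hD : D ∈ diffOpOrder n) : casimirProj lam mu n n D ∈ diffOpOrder n := by
  simpa using add_mem (lowerOp_le n (casimirProj_sub_mem hδ le_rfl hD)) hD

theorem casimirProj_of_eigenvector (hδ : ¬ IsCritical (mu - lam)) {m n : ℕ} (hm : m ≤ n) {D : Op}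
    (hD : casimir (lieOp lam mu) D = casimirValue (mu - lam) n • D) :
    casimirProj lam mu n m D = D := by
  induction m with
  | zero => rfl
  | succ m ih =>
    rw [casimirProj_succ_apply, hD, ← sub_smul,
      inv_smul_smul₀ (casimirValue_sub_ne_zero hδ (Nat.lt_of_succ_le hm)), ih (by omega)]

theorem commute_casimirProj (lam mu : ℂ) (n m : ℕ) {f : SuperFn} (hf : f ∈ spoHamiltonians) :
    Commute (casimirProj lam mu n m) (lieOp lam mu f) := by
  induction m with
  | zero => exact Commute.one_left _
  | succ m ih =>
    exact ih.mul_left (((commute_casimir_lieOp lam mu hf).sub_left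
      ((Commute.one_left _).smul_left _)).smul_left _)

/-! ### The quantization -/

/-- The unique lift of a symbol of degree `n / 2` to an eigenvector of the Casimir operator. -/
noncomputable def symbolLift (hδ : ¬ IsCritical (mu - lam)) (n : ℕ) : Symbol n →ₗ[ℂ] diffOp :=
  (lowerOrder n).liftQ
    ((casimirProj lam mu n n ∘ₗ (diffOpOrder n).subtype).codRestrict diffOp
      fun D => diffOpOrder_le_diffOp n (casimirProj_mem hδ D.2))
    fun _ hD => Subtype.ext (casimirProj_of_mem_lowerOp lam mu n (mem_lowerOrder.1 hD))

theorem symbolLift_principalSymbol (hδ : ¬ IsCritical (mu - lam)) (n : ℕ) (D : diffOpOrder n) :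
    (symbolLift hδ n (principalSymbol n D) : Op) = casimirProj lam mu n n D := rfl

/-- The quantization that lifts symbols to eigenvectors of the Casimir operator. -/
noncomputable def casimirQuantization (hδ : ¬ IsCritical (mu - lam)) : SymbolSpace →ₗ[ℂ] diffOp :=
  DirectSum.toModule ℂ ℕ diffOp (symbolLift hδ)

theorem casimirQuantization_lof (hδ : ¬ IsCritical (mu - lam)) (n : ℕ) (D : diffOpOrder n) :
    (casimirQuantization hδ (DirectSum.lof ℂ ℕ Symbol n (principalSymbol n D)) : Op) =
      casimirProj lam mu n n D := by
  rw [casimirQuantization, DirectSum.toModule_lof, symbolLift_principalSymbol]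

/-- A linear map from symbols to operators that preserves the principal symbol is bijective. -/
theorem bijective_of_principalSymbol_eq {Q : SymbolSpace →ₗ[ℂ] diffOp}
    (hQ : ∀ (n : ℕ) (S : Symbol n), ∃ D : diffOpOrder n,
      (Q (DirectSum.lof ℂ ℕ Symbol n S) : Op) = D ∧ principalSymbol n D = S) :
    Function.Bijective Q := by
  constructor
  · have key (n : ℕ) : ∀ s : SymbolSpace, (∀ i, n ≤ i → s i = 0) →
        (Q s : Op) ∈ lowerOp n ∧ (Q s = 0 → s = 0) := by
      induction n with
      | zero =>
        intro s hs
        have h : s = 0 := DFinsupp.ext fun i => hs i i.zero_le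
        simp [h]
      | succ n ih =>
        intro s hs
        obtain ⟨D, hD, hDs⟩ := hQ n (s n)
        obtain ⟨h1, h2⟩ := ih (s - DirectSum.lof ℂ ℕ Symbol n (s n)) fun i hi => by
          rw [DirectSum.sub_apply]
          rcases hi.eq_or_lt with rfl | hi
          · rw [DirectSum.lof_apply, sub_self]
          · rw [hs i hi, DirectSum.lof_eq_of, DirectSum.of_eq_of_ne _ _ _ hi.ne', sub_zero]
        rw [map_sub, Submodule.coe_sub, hD] at h1
        have h3 : (Q s : Op) ∈ diffOpOrder n := by
          simpa using add_mem (lowerOp_le n h1) D.2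
        refine ⟨h3, fun h0 => ?_⟩
        have h4 : s n = 0 := by
          rw [← hDs, ← map_zero (principalSymbol n), principalSymbol_eq_iff]
          simpa [h0] using h1
        rw [h4, map_zero, sub_zero] at h2
        exact h2 h0
    refine (injective_iff_map_eq_zero Q).2 fun s hs => ?_
    obtain ⟨n, hn⟩ : ∃ n, ∀ i, n ≤ i → s i = 0 := by
      classical
      refine ⟨s.support.sup id + 1, fun i hi => ?_⟩
      by_contra h
      have := Finset.le_sup (f := id) (DFinsupp.mem_support_iff.2 h)
      simp only [id] at this
      omega
    exact (key n s hn).2 hs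
  · have key (n : ℕ) : ∀ D ∈ lowerOp n, ∃ s, (Q s : Op) = D := by
      induction n with
      | zero =>
        intro D hD
        rw [lowerOp, Submodule.mem_bot] at hD
        exact ⟨0, by simp [hD]⟩
      | succ n ih =>
        intro D hD
        obtain ⟨E, hE, hED⟩ := hQ n (principalSymbol n ⟨D, hD⟩)
        obtain ⟨s, hs⟩ := ih _ (principalSymbol_eq_iff.1 hED.symm)
        refine ⟨s + DirectSum.lof ℂ ℕ Symbol n (principalSymbol n ⟨D, hD⟩), ?_⟩
        rw [map_add, Submodule.coe_add, hs, hE]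
        simp
    rintro ⟨D, hD⟩
    obtain ⟨n, hn⟩ := (Submodule.mem_iSup_of_directed diffOpOrder
      (monotone_nat_of_le_succ fun n => diffOpOrder_mono n.le_succ).directed_le).1 hD
    obtain ⟨s, hs⟩ := key (n + 1) D hn
    exact ⟨s, Subtype.ext hs⟩

theorem isEquivariantQuantization_casimirQuantization (hδ : ¬ IsCritical (mu - lam)) :
    IsEquivariantQuantization lam mu (casimirQuantization hδ) := by
  have hQ (n : ℕ) (S : Symbol n) : ∃ D : diffOpOrder n,
      (casimirQuantization hδ (DirectSum.lof ℂ ℕ Symbol n S) : Op) = D ∧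
        principalSymbol n D = S := by
    obtain ⟨D, rfl⟩ := principalSymbol_surjective n S
    exact ⟨⟨_, casimirProj_mem hδ D.2⟩, casimirQuantization_lof hδ n D,
      principalSymbol_eq_iff.2 (casimirProj_sub_mem hδ le_rfl D.2)⟩
  refine ⟨bijective_of_principalSymbol_eq hQ, hQ, fun f hf => ?_⟩
  refine DirectSum.linearMap_ext ℂ fun n => LinearMap.ext fun S => Subtype.ext ?_
  obtain ⟨D, rfl⟩ := principalSymbol_surjective n S
  simp only [LinearMap.comp_apply]
  rw [lieSymbol_lof_principalSymbol, casimirQuantization_lof]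
  change lieOp lam mu f (casimirQuantization hδ _ : Op) = _
  rw [casimirQuantization_lof]
  exact (LinearMap.congr_fun (commute_casimirProj lam mu n n hf).eq (D : Op)).symm

/-- An equivariant quantization sends symbols of degree `n / 2` to eigenvectors of the Casimir
operator, and these are fixed by the projection that defines `casimirQuantization`. -/
theorem eq_casimirQuantization (hδ : ¬ IsCritical (mu - lam)) {Q : SymbolSpace →ₗ[ℂ] diffOp}
    (hQ : IsEquivariantQuantization lam mu Q) : Q = casimirQuantization hδ := by
  refine DirectSum.linearMap_ext ℂ fun n => LinearMap.ext fun S => Subtype.ext ?_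
  obtain ⟨D, hD, rfl⟩ := hQ.principalSymbol_eq n S
  have h := casimir_intertwine (ρ := lieSymbol lam mu) (σ := lieOp lam mu) (diffOp.subtype ∘ₗ Q)
    (fun f hf s => congrArg Subtype.val (LinearMap.congr_fun (hQ.equivariant f hf) s).symm)
    (DirectSum.lof ℂ ℕ Symbol n (principalSymbol n D))
  rw [casimir_lieSymbol, map_smul, LinearMap.comp_apply, Submodule.subtype_apply, hD] at h
  rw [LinearMap.comp_apply, LinearMap.comp_apply, hD, casimirQuantization_lof,
    casimirProj_of_eigenvector hδ le_rfl h.symm]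

end SuperContact

theorem theorem4p3 (lam mu : ℂ) (hδ : ¬ SuperContact.IsCritical (mu - lam)) :
    ∃! Q : SuperContact.SymbolSpace →ₗ[ℂ] SuperContact.diffOp,
      SuperContact.IsEquivariantQuantization lam mu Q :=
  ⟨SuperContact.casimirQuantization hδ,
    SuperContact.isEquivariantQuantization_casimirQuantization hδ,
    fun _ hQ => SuperContact.eq_casimirQuantization hδ hQ⟩
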